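/- Let $D=[0,1]^2\ni(t,x)$. For $q\in L^2([0,1])$ put $\eta(q)(x)=\exp\int_0^x q$ and $\varphi(q)(x)=\int_0^x\eta(q)$. Let $$Q=\Big\{q\in L^2([0,1]) : \int_0^1 q=0,\ \int_0^1\eta(q)=1\Big\},\qquad T_qQ=\Big\{X\in L^2([0,1]):\int_0^1X=\int_0^1X\varphi(q)=0\Big\},$$ with the Riemannian metric $G(q)(X,Y)=\int_0^1 XY/\eta(q)\,dx$. Thus $f^\sharp=\eta(q)f$ for a covector $f\in T_q^*Q=\{f\in L^2([0,1]):\eta(q)f\in T_qQ\}$, $X^\flat=X/\eta(q)$ for $X\in T_qQ$, and $\|f\|_q^2=\int_0^1\eta(q)f^2\,dx$. Let $\pi_q$ be the $G(q)$-orthogonal projection onto $T_qQ$ and $\pi_q^*$ its $L^2$-adjoint. For a function or a measure $f$ on $[0,1]$ let $\mathcal U(f,q)(x)=\frac12\int_x^1\eta(q)\,f\,dy$ (integration against $f$ if it is a measure). Fix $(p_0,q_0)$ and a path $(p,q)\in\mathcal C^0$, that is: $q\in H^2([0,1],L^2([0,1]))$, $\dot q=\eta(q)p$, $q(t)\in Q$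 and $p(t)\in T^*_{q(t)}Q$ for all $t\in[0,1]$, $p(0)=p_0$, $q(0)=q_0$. Write $\eta(t,x)=\eta(q(t))(x)$ and let $\frac{D}{Dt}\dot q=\pi_q\big(\eta(q)(\dot p+\mathcal U(p^2,q))\big)$ be the covariant derivative of $\dot q$ along $q$ in $(Q,G)$. Let $P$ be a real-valued function of $(p(1),q(1))$. Let $\mathcal M_0(D)$ be the set of finite positive Borel measures $\mu=\int_0^1\delta_t\otimes\mu_t\,dt$ on $D$ whose time disintegration can be chosen to be weakly continuous at $t=0$ with $\mu_{0}=0$. "$\partial_t\mu$ is a measure" means that there is a (then unique) finite signed measure $\partial_t\mu$ on $(0,1)\times[0,1]$ with $\int\partial_tf\,d\mu=-\int f\,d\partial_t\mu$ for all continuous $f$ on $D$ that are $C^1$ in $t$ and vanish at $t=0$ and $t=1$. For a positive measure $\mu$ and a signed measure $\nu$ on $D$ put $$\mathrm{FR}_\eta(\mu,\nu)=\int_D r\Big(\frac{d\mu}{d\lambda},\frac{d\nu}{d\lambda}\Big)\eta\,d\lambda\in[0,+\infty],\qquad r(a,b)=\begin{cases}\frac{b^2}{4a}&a>0\\0&a=b=0\\+\infty&\text{otherwise,}\end{cases}$$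 for any finite $\lambda$ dominating $\mu$ and $\nu$, and $\mathrm{FR}_\eta(\mu,\partial_t\mu)=+\infty$ if $\partial_t\mu$ is not a measure. For $\Delta\in\mathcal M_0(D)$ let $$\mathcal F(\Delta,p,q)=\mathrm{FR}_\eta(\Delta,\partial_t\Delta)+\int_0^1\Big\|\Big(\frac{D}{Dt}\dot q\Big)^\flat+\pi_q^*\big(\mathcal U(\Delta_t,q)\big)\Big\|_q^2dt+P(p(1),q(1)),$$ $$w=\eta\int_0^x\Big(\frac{D}{Dt}\dot q+\big(\pi_q^*(\mathcal U(\Delta_t,q))\big)^\sharp\Big)dy .$$ **Theorem.** Let $\Delta\in\mathcal M_0(D)$. Then $\Delta$ minimizes $\mathcal F(\cdot,p,q)$ over $\mathcal M_0(D)$ if and only if both of the following conditions hold: 1. $\mathrm{FR}_\eta(\mu,\partial_t\mu)\ge\langle\mu,-w\rangle$ for every $\mu\in\mathcal M_0(D)$ such that $\partial_t\mu$ is a measure; 2. $\partial_t\Delta$ is a measure and $\mathrm{FR}_\eta(\Delta,\partial_t\Delta)+\langle\Delta,w\rangle=0$. Moreover, if $\partial_t\Delta$ is a measure, then $w$ is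 $\mu$-integrable for every $\mu\in\mathcal M_0(D)$ such that $\partial_t\mu$ is a measure, so that these pairings are meaningful. -/

import Mathlib

open MeasureTheory ProbabilityTheory Set Filter Topology

noncomputable section

namespace FisherRao

/-! ### The domain and the Hilbert submanifold of reparametrizations -/

/-- The time (or space) interval `[0,1]`. -/
abbrev I01 : Set ℝ := Icc 0 1

/-- The square `D = [0,1] × [0,1]` of pairs `(t, x)` of a time and a position. -/
abbrev D : Set (ℝ × ℝ) := I01 ×ˢ I01

/-- The Hilbert space `L²([0,1])`. -/
abbrev L2 : Type := Lp ℝ 2 (volume.restrict I01)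

/-- `η(q)(x) = exp (∫₀ˣ q)`. -/
def eta (q : L2) (x : ℝ) : ℝ := Real.exp (∫ u in (0 : ℝ)..x, q u)

/-- `φ(q)(x) = ∫₀ˣ η(q)`. -/
def phi (q : L2) (x : ℝ) : ℝ := ∫ y in (0 : ℝ)..x, eta q y

/-- The submanifold `Q` of `L²([0,1])`, which represents the group of diffeomorphisms. -/
def Q : Set L2 :=
  {q | ∫ x in (0 : ℝ)..1, q x = 0 ∧ ∫ x in (0 : ℝ)..1, eta q x = 1}

/-- The cotangent space `T*_q Q`: the `p` such that `η(q) p` is tangent to `Q` at `q`, where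
`X` is tangent when `∫ X = 0` and `∫ X φ(q) = 0`. -/
def cotangent (q : L2) : Set L2 :=
  {p | ∫ x in (0 : ℝ)..1, eta q x * p x = 0 ∧ ∫ x in (0 : ℝ)..1, eta q x * p x * phi q x = 0}

/-- The metric `G(q)(X,Y) = ∫ X Y / η(q)`. -/
def metric (q : L2) (X Y : ℝ → ℝ) : ℝ := ∫ x in (0 : ℝ)..1, X x * Y x / eta q x

/-- The dual scalar product `∫ η(q) f g`. -/
def cometric (q : L2) (f g : ℝ → ℝ) : ℝ := ∫ x in (0 : ℝ)..1, eta q x * f x * g x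

/-- The squared dual norm `∫ η(q) f²`, with values in `[0,∞]`. -/
def conormSq (q : L2) (f : ℝ → ℝ) : ENNReal :=
  ∫⁻ x in I01, ENNReal.ofReal (eta q x * f x ^ 2)

/-- The Hilbert matrix of size two. -/
def H2 : Matrix (Fin 2) (Fin 2) ℝ := !![1, 1 / 2; 1 / 2, 1 / 3]

/-- The orthogonal projection `π_q` onto `T_q Q` for the metric `G(q)`. -/
def proj (q : L2) (f : ℝ → ℝ) (x : ℝ) : ℝ :=
  f x - ![eta q x, phi q x * eta q x] ⬝ᵥ
    (Matrix.mulVec H2⁻¹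
      ![metric q f (eta q), metric q f (fun y => phi q y * eta q y)])

/-- The dual projection `π*_q` onto `T*_q Q`. -/
def projStar (q : L2) (f : ℝ → ℝ) (x : ℝ) : ℝ :=
  f x - ![1, phi q x] ⬝ᵥ
    (Matrix.mulVec H2⁻¹ ![cometric q f (fun _ => 1), cometric q f (phi q)])

/-- `U(f,q)(x) = ½ ∫ₓ¹ η(q) f dy` for a function `f`. -/
def U (q : L2) (f : ℝ → ℝ) (x : ℝ) : ℝ := 1 / 2 * ∫ y in x..1, eta q y * f y

/-- `U(m,q)(x) = ½ ∫_{[x,1]} η(q) dm` for a measure `m`. -/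
def UMeas (q : L2) (m : Measure ℝ) (x : ℝ) : ℝ := 1 / 2 * ∫ y in Icc x 1, eta q y ∂m

/-! ### Paths -/

/-- `u` is (the continuous representative of) an element of `H¹([0,1], X)` with derivative
`v ∈ L²([0,1], X)`. -/
def HasH1Deriv {X : Type*} [NormedAddCommGroup X] [NormedSpace ℝ X] (u v : ℝ → X) : Prop :=
  MemLp v 2 (volume.restrict I01) ∧ ∀ t ∈ I01, u t = u 0 + ∫ s in (0 : ℝ)..t, v s

/-- The set `C⁰` of paths `(p,q)` in `T*Q` with `q ∈ H²([0,1], L²([0,1]))`, `q̇ = η(q) p` and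
initial condition `(p₀,q₀)`. -/
def pathSet (p₀ q₀ : L2) : Set ((ℝ → L2) × (ℝ → L2)) :=
  {pq | (∃ v a : ℝ → L2, HasH1Deriv pq.2 v ∧ HasH1Deriv v a ∧
          ∀ t ∈ I01, ∀ᵐ x ∂(volume.restrict I01), v t x = eta (pq.2 t) x * pq.1 t x) ∧
        (∀ t ∈ I01, pq.2 t ∈ Q ∧ pq.1 t ∈ cotangent (pq.2 t)) ∧
        pq.1 0 = p₀ ∧ pq.2 0 = q₀}

/-- The covariant derivative `D q̇ / Dt` in `(Q, G)` along a path with `q̇ = η(q) p`: the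
projection by `π_q` of the covariant derivative of `q̇` in `L²([0,1])` for the metric
`∫ X Y / η(q)`, which is `η(q) (ṗ + U(p²,q))`. -/
def accel (p q : ℝ → L2) (t : ℝ) : ℝ → ℝ :=
  proj (q t) fun x => eta (q t) x * ((deriv p t : L2) x + U (q t) (fun y => p t y ^ 2) x)

/-- The covector `(D q̇ / Dt)^♭`; the metric is multiplication by `1 / η(q)`. -/
def accelFlat (p q : ℝ → L2) (t x : ℝ) : ℝ := accel p q t x / eta (q t) x

/-- `η(q)` as a function on `D`. -/
def etaPath (q : ℝ → L2) (z : ℝ × ℝ) : ℝ := eta (q z.1) z.2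

/-! ### Measures on the square -/

/-- The positive and finite measures on `D`, as measures on the plane that vanish off `D`. -/
def measD : Set (Measure (ℝ × ℝ)) := {μ | IsFiniteMeasure μ ∧ μ Dᶜ = 0}

/-- `κ` is a disintegration `μ = ∫₀¹ δ_t ⊗ κ t dt` of `μ` in time. -/
def IsDisintegration (μ : Measure (ℝ × ℝ)) (κ : Kernel ℝ ℝ) : Prop :=
  IsSFiniteKernel κ ∧ μ = (volume.restrict I01).compProd κ

/-- `M₀(D)`: the measures on `D` whose disintegration vanishes at time `0`. As disintegrations
are determined for almost every time only, the value at time `0` is that of a disintegration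
which is continuous there (for positive measures and a zero limit, weak convergence is
convergence of the total mass). -/
def measD0 : Set (Measure (ℝ × ℝ)) :=
  {μ | μ ∈ measD ∧ ∃ κ : Kernel ℝ ℝ, IsDisintegration μ κ ∧ κ 0 = 0 ∧
    Tendsto (fun t => κ t univ) (𝓝[>] 0) (𝓝 0)}

open Classical in
/-- The disintegration `t ↦ μ_t` of `μ`, determined for almost every time `t ∈ [0,1]`. -/
def slice (μ : Measure (ℝ × ℝ)) : Kernel ℝ ℝ :=
  if h : ∃ κ : Kernel ℝ ℝ, IsDisintegration μ κ then h.choose else 0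

/-- The integral of a function against a finite signed measure. -/
def signedIntegral (δ : SignedMeasure (ℝ × ℝ)) (f : ℝ × ℝ → ℝ) : ℝ :=
  ∫ z, f z ∂δ.toJordanDecomposition.posPart - ∫ z, f z ∂δ.toJordanDecomposition.negPart

/-- The distributional time derivative of `μ` on `(0,1) × [0,1]` is the finite signed measure
`δ`. The test functions `f` are continuous on `D` and `C¹` in time (with derivative `g`), and
they vanish at the times `0` and `1`. -/
def IsTimeDeriv (μ : Measure (ℝ × ℝ)) (δ : SignedMeasure (ℝ × ℝ)) : Prop :=
  δ.totalVariation (Ioo (0 : ℝ) 1 ×ˢ I01)ᶜ = 0 ∧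
  ∀ f g : ℝ × ℝ → ℝ, ContinuousOn f D → ContinuousOn g D →
    (∀ t ∈ I01, ∀ x ∈ I01, HasDerivWithinAt (fun s => f (s, x)) (g (t, x)) I01 t) →
    (∀ x ∈ I01, f (0, x) = 0 ∧ f (1, x) = 0) →
    ∫ z, g z ∂μ = - signedIntegral δ f

/-! ### The Fisher-Rao functional and the relaxed acceleration -/

/-- `r(x,y) = y² / (4x)` if `x > 0`, `r(0,0) = 0`, and `r = +∞` otherwise. -/
def r (x y : ℝ) : ENNReal :=
  open Classical in
  if 0 < x then ENNReal.ofReal (1 / 4 * (y ^ 2 / x)) else if x = 0 ∧ y = 0 then 0 else ⊤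

/-- The Fisher-Rao functional `FR_f(μ,ν) = ∫ r(dμ/dλ, dν/dλ) f dλ`, with the dominating measure
`λ = μ + |ν|`. By homogeneity of `r` the value does not depend on `λ`. -/
def FR (f : ℝ × ℝ → ℝ) (μ : Measure (ℝ × ℝ)) (ν : SignedMeasure (ℝ × ℝ)) : ENNReal :=
  ∫⁻ z, r (μ.rnDeriv (μ + ν.totalVariation) z).toReal (ν.rnDeriv (μ + ν.totalVariation) z)
      * ENNReal.ofReal (f z) ∂(μ + ν.totalVariation)

/-- `FR_f(μ,∂_t μ)`, which is `+∞` if `∂_t μ` is not a measure. -/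
def FRt (f : ℝ × ℝ → ℝ) (μ : Measure (ℝ × ℝ)) : ENNReal :=
  ⨅ (δ : SignedMeasure (ℝ × ℝ)) (_ : IsTimeDeriv μ δ), FR f μ δ

/-- The reduced relaxed acceleration functional
`F(Δ,p,q) = FR_η(Δ,∂_t Δ) + ∫₀¹ ‖(D q̇ / Dt)^♭ + π*_q U(Δ,q)‖²_q dt + P(p(1),q(1))`. -/
def F (P : L2 → L2 → ℝ) (p q : ℝ → L2) (Δ : Measure (ℝ × ℝ)) : EReal :=
  ((FRt (etaPath q) Δ + ∫⁻ t in I01, conormSq (q t)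
      (fun x => accelFlat p q t x + projStar (q t) (UMeas (q t) (slice Δ t)) x) : ENNReal) : EReal)
    + (P (p 1) (q 1) : EReal)

/-- `w = η ∫₀ˣ (D q̇ / Dt + (π*_q U(Δ,q))^♯) dy`, where `f^♯ = η(q) f` is the tangent vector
that corresponds to the covector `f`. -/
def w (p q : ℝ → L2) (Δ : Measure (ℝ × ℝ)) (z : ℝ × ℝ) : ℝ :=
  eta (q z.1) z.2 * ∫ y in (0 : ℝ)..z.2,
    (accel p q z.1 y + eta (q z.1) y * projStar (q z.1) (UMeas (q z.1) (slice Δ z.1)) y)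

end FisherRao

end

/-!
The functional is the sum of the Fisher-Rao term, which is convex and positively homogeneous
(`FR_combination_le`), of a quadratic term, and of a constant. Minimality over the convex cone
`M₀(D)` is therefore equivalent to first order conditions: the first variation is nonnegative in the
direction of every element of the cone, and it vanishes in the direction of `Δ` itself, along which
one can move both ways. No duality is needed.

The slope of the quadratic term is the pairing with `w`. At a fixed time, the covector in the
functional is `π*_q g` with `g = ṗ + U(p²,q) + U(Δ_t,q)`, because the covector of
`π_q (η(q) f)` is `π*_q f` (`proj_eta_mul`). The projection is self-adjoint for the weight `η(q)`
(`integral_pr_mul_pr`), so the derivative of `‖π*_q g‖²` in the direction of a measure `m` is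
`2 ∫ η(q) (π*_q g) U(m,q)`, and exchanging the integrals gives
`∫ η(q)(y) (∫₀^y η(q) π*_q g) dm(y)` (`integral_mul_UMeas`), which is the pairing of `w` with `m`.
Integrating in time yields a tangent inequality (`add_integral_w_sub_le`) and an exact expansion
along lines (`integral_nrg_line`).

All integrals in time converge for the following reasons. If `∂_t μ` is a measure, then the masses
of the slices of `μ` are bounded (`IsTimeDeriv.exists_map_fst_le`): the primitive in time of any
continuous function of mean zero is a test function. The momentum `p = q̇ / η(q)` is continuous in
time and its speed is square integrable (`exists_momentum_bound`). Since elements of `L²` have no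
canonical values, joint measurability in `(t,x)` holds for suitable representatives only; they are
obtained by differentiating primitives in `x`, which are continuous on `L² × ℝ` (`ev`).

A minimizer has finite Fisher-Rao term because the zero measure has a finite value, hence `∂_t Δ`
is a measure; it is unique (`IsTimeDeriv.unique`), so the infimum in the definition of the
functional is the value at `∂_t Δ`.
-/

noncomputable section

namespace FisherRao

/-! ### The Fisher-Rao functional is convex and positively homogeneous -/

lemma r_mul (c : ℝ) (hc : 0 ≤ c) (x y : ℝ) : r (c * x) (c * y) = ENNReal.ofReal c * r x y := by
  rcases hc.eq_or_lt with rfl | hc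
  · simp [r]
  unfold r
  have hpos : 0 < c * x ↔ 0 < x := by simp [hc]
  by_cases hx : 0 < x
  · rw [if_pos (hpos.2 hx), if_pos hx, ← ENNReal.ofReal_mul hc.le]
    congr 1
    field_simp
  · rw [if_neg (fun h => hx (hpos.1 h)), if_neg hx]
    by_cases h0 : x = 0 ∧ y = 0
    · simp [h0]
    · have : ¬ (c * x = 0 ∧ c * y = 0) := by simpa [hc.ne'] using h0
      rw [if_neg this, if_neg h0, ENNReal.mul_top (by simpa using hc)]

lemma r_add_le (x y x' y' : ℝ) : r (x + x') (y + y') ≤ r x y + r x' y' := by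
  have top : ∀ x y : ℝ, ¬ 0 < x → ¬ (x = 0 ∧ y = 0) → r x y = ⊤ := by
    intro x y h1 h2
    simp only [r, if_neg h1, if_neg h2]
  have zero : ∀ x y : ℝ, x = 0 ∧ y = 0 → r x y = 0 := by
    intro x y h
    simp [r, h]
  by_cases hx : 0 < x
  · by_cases hx' : 0 < x'
    · simp only [r, if_pos hx, if_pos hx', if_pos (add_pos hx hx')]
      rw [← ENNReal.ofReal_add (by positivity) (by positivity)]
      apply ENNReal.ofReal_le_ofReal
      have : (y + y') ^ 2 / (x + x') ≤ y ^ 2 / x + y' ^ 2 / x' := by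
        rw [div_add_div _ _ hx.ne' hx'.ne', div_le_div_iff₀ (by positivity) (by positivity)]
        nlinarith [sq_nonneg (y * x' - y' * x)]
      linarith
    · by_cases h : x' = 0 ∧ y' = 0
      · simp [h]
      · simp [top _ _ hx' h]
  · by_cases h : x = 0 ∧ y = 0
    · simp [h]
    · simp [top _ _ hx h]

lemma measurable_r : Measurable fun z : ℝ × ℝ => r z.1 z.2 := by
  unfold r
  refine Measurable.ite (measurableSet_lt measurable_const measurable_fst) (by fun_prop) ?_
  refine Measurable.ite ?_ measurable_const measurable_const
  exact (measurableSet_eq_fun measurable_fst measurable_const).inter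
    (measurableSet_eq_fun measurable_snd measurable_const)

lemma rnDeriv_toReal_chain {α : Type*} [MeasurableSpace α] (μ m l : Measure α)
    [IsFiniteMeasure μ] [IsFiniteMeasure m] [IsFiniteMeasure l] (h : μ ≪ m) :
    (fun z => (m.rnDeriv l z).toReal * (μ.rnDeriv m z).toReal) =ᵐ[l]
      fun z => (μ.rnDeriv l z).toReal := by
  filter_upwards [Measure.rnDeriv_mul_rnDeriv (κ := l) h] with z hz
  rw [← hz, Pi.mul_apply, ENNReal.toReal_mul, mul_comm]

instance isFiniteMeasure_totalVariation (δ : SignedMeasure (ℝ × ℝ)) :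
    IsFiniteMeasure δ.totalVariation := by
  unfold SignedMeasure.totalVariation; infer_instance

lemma totalVariation_combination_absolutelyContinuous {ν ν' : SignedMeasure (ℝ × ℝ)}
    {l : Measure (ℝ × ℝ)} (hν : ν.totalVariation ≪ l) (hν' : ν'.totalVariation ≪ l) (a b : ℝ) :
    (a • ν + b • ν').totalVariation ≪ l := by
  have key : ∀ s : SignedMeasure (ℝ × ℝ), s.totalVariation ≪ l ↔
      s ≪ᵥ l.toENNRealVectorMeasure := by
    intro s
    rw [SignedMeasure.absolutelyContinuous_ennreal_iff,
      VectorMeasure.ennrealToMeasure_toENNRealVectorMeasure]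
  rw [key] at hν hν' ⊢
  exact VectorMeasure.AbsolutelyContinuous.add
    (VectorMeasure.AbsolutelyContinuous.smul (r := a) hν)
    (VectorMeasure.AbsolutelyContinuous.smul (r := b) hν')

/-- By homogeneity of `r`, the Fisher-Rao functional may be computed with any finite dominating
measure. -/
lemma FR_eq_lintegral {f : ℝ × ℝ → ℝ} {μ l : Measure (ℝ × ℝ)} {ν : SignedMeasure (ℝ × ℝ)}
    [IsFiniteMeasure μ] [IsFiniteMeasure l] (hμ : μ ≪ l) (hν : ν.totalVariation ≪ l)
    (hf : AEMeasurable f l) :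
    FR f μ ν = ∫⁻ z, r (μ.rnDeriv l z).toReal (ν.rnDeriv l z) * ENNReal.ofReal (f z) ∂l := by
  obtain ⟨m, hm⟩ : ∃ m, m = μ + ν.totalVariation := ⟨_, rfl⟩
  have : IsFiniteMeasure m := by rw [hm]; infer_instance
  have hml : m ≪ l := hm ▸ Measure.AbsolutelyContinuous.add_left hμ hν
  have h1 : μ ≪ m := hm ▸ Measure.absolutelyContinuous_of_le (Measure.le_add_right le_rfl)
  have h2 : ν.totalVariation ≪ m := hm ▸
    Measure.absolutelyContinuous_of_le (Measure.le_add_left le_rfl)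
  have h3 : ν.toJordanDecomposition.posPart ≪ m := Measure.AbsolutelyContinuous.trans
    (Measure.absolutelyContinuous_of_le (Measure.le_add_right le_rfl)) h2
  have h4 : ν.toJordanDecomposition.negPart ≪ m := Measure.AbsolutelyContinuous.trans
    (Measure.absolutelyContinuous_of_le (Measure.le_add_left le_rfl)) h2
  have hmeas : AEMeasurable (fun z => r (μ.rnDeriv m z).toReal (ν.rnDeriv m z)
      * ENNReal.ofReal (f z)) l := by
    refine AEMeasurable.mul ?_ hf.ennreal_ofReal
    exact (measurable_r.comp ((Measure.measurable_rnDeriv μ m).ennreal_toReal.prodMk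
      (SignedMeasure.measurable_rnDeriv ν m))).aemeasurable
  rw [FR, ← hm, ← lintegral_rnDeriv_mul hml hmeas]
  refine lintegral_congr_ae ?_
  filter_upwards [rnDeriv_toReal_chain μ m l h1, rnDeriv_toReal_chain _ m l h3,
    rnDeriv_toReal_chain _ m l h4, Measure.rnDeriv_lt_top m l] with z e1 e2 e3 e4
  rw [← mul_assoc]
  congr 1
  rw [SignedMeasure.rnDeriv_def, SignedMeasure.rnDeriv_def, ← e1]
  dsimp only
  rw [← e2, ← e3, ← mul_sub, r_mul _ ENNReal.toReal_nonneg, ENNReal.ofReal_toReal e4.ne]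

/-- The Fisher-Rao functional is subadditive and positively homogeneous. -/
lemma FR_combination_le {f : ℝ × ℝ → ℝ} {μ μ' : Measure (ℝ × ℝ)} {ν ν' : SignedMeasure (ℝ × ℝ)}
    [IsFiniteMeasure μ] [IsFiniteMeasure μ'] (a b : NNReal)
    (hf : AEMeasurable f (μ + μ' + (ν.totalVariation + ν'.totalVariation))) :
    FR f (a • μ + b • μ') ((a : ℝ) • ν + (b : ℝ) • ν') ≤ a * FR f μ ν + b * FR f μ' ν' := by
  obtain ⟨l, hl⟩ : ∃ l, l = μ + μ' + (ν.totalVariation + ν'.totalVariation) := ⟨_, rfl⟩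
  rw [← hl] at hf
  have : IsFiniteMeasure l := by rw [hl]; infer_instance
  have hμ : μ ≪ l := hl ▸ Measure.absolutelyContinuous_of_le
    (Measure.le_add_right (Measure.le_add_right le_rfl))
  have hμ' : μ' ≪ l := hl ▸ Measure.absolutelyContinuous_of_le
    (Measure.le_add_right (Measure.le_add_left le_rfl))
  have hν : ν.totalVariation ≪ l := hl ▸ Measure.absolutelyContinuous_of_le
    (Measure.le_add_left (Measure.le_add_right le_rfl))
  have hν' : ν'.totalVariation ≪ l := hl ▸ Measure.absolutelyContinuous_of_le
    (Measure.le_add_left (Measure.le_add_left le_rfl))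
  have hμs : a • μ + b • μ' ≪ l := by
    refine Measure.AbsolutelyContinuous.add_left ?_ ?_
    · exact (Measure.AbsolutelyContinuous.rfl.smul_left a).trans hμ
    · exact (Measure.AbsolutelyContinuous.rfl.smul_left b).trans hμ'
  have hνs : ((a : ℝ) • ν + (b : ℝ) • ν').totalVariation ≪ l :=
    totalVariation_combination_absolutelyContinuous hν hν' a b
  rw [FR_eq_lintegral hμs hνs hf, FR_eq_lintegral hμ hν hf, FR_eq_lintegral hμ' hν' hf]
  have m1 : AEMeasurable (fun z => r (μ.rnDeriv l z).toReal (ν.rnDeriv l z)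
      * ENNReal.ofReal (f z)) l := by
    refine AEMeasurable.mul ?_ hf.ennreal_ofReal
    exact (measurable_r.comp ((Measure.measurable_rnDeriv μ l).ennreal_toReal.prodMk
      (SignedMeasure.measurable_rnDeriv ν l))).aemeasurable
  have m2 : AEMeasurable (fun z => r (μ'.rnDeriv l z).toReal (ν'.rnDeriv l z)
      * ENNReal.ofReal (f z)) l := by
    refine AEMeasurable.mul ?_ hf.ennreal_ofReal
    exact (measurable_r.comp ((Measure.measurable_rnDeriv μ' l).ennreal_toReal.prodMk
      (SignedMeasure.measurable_rnDeriv ν' l))).aemeasurable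
  rw [← lintegral_const_mul'' _ m1, ← lintegral_const_mul'' _ m2,
    ← lintegral_add_left' (m1.const_mul _)]
  refine lintegral_mono_ae ?_
  filter_upwards [Measure.rnDeriv_add' (a • μ) (b • μ') l, Measure.rnDeriv_smul_left μ l a,
    Measure.rnDeriv_smul_left μ' l b, SignedMeasure.rnDeriv_add ((a : ℝ) • ν) ((b : ℝ) • ν') l,
    SignedMeasure.rnDeriv_smul ν l (a : ℝ), SignedMeasure.rnDeriv_smul ν' l (b : ℝ),
    Measure.rnDeriv_lt_top μ l, Measure.rnDeriv_lt_top μ' l] with z e1 e2 e3 e4 e5 e6 t1 t2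
  have hx : ((a • μ + b • μ').rnDeriv l z).toReal =
      a * (μ.rnDeriv l z).toReal + b * (μ'.rnDeriv l z).toReal := by
    rw [e1, Pi.add_apply, e2, e3, Pi.smul_apply, Pi.smul_apply, ENNReal.smul_def, ENNReal.smul_def,
      smul_eq_mul, smul_eq_mul, ENNReal.toReal_add (ENNReal.mul_ne_top ENNReal.coe_ne_top t1.ne)
      (ENNReal.mul_ne_top ENNReal.coe_ne_top t2.ne), ENNReal.toReal_mul, ENNReal.toReal_mul]
    rfl
  have hy : ((a : ℝ) • ν + (b : ℝ) • ν').rnDeriv l z =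
      a * ν.rnDeriv l z + b * ν'.rnDeriv l z := by
    rw [e4, Pi.add_apply, e5, e6]
    rfl
  rw [hx, hy, ← mul_assoc, ← mul_assoc, ← add_mul]
  refine mul_le_mul_left ?_ _
  refine (r_add_le _ _ _ _).trans ?_
  rw [r_mul _ a.coe_nonneg, r_mul _ b.coe_nonneg, ENNReal.ofReal_coe_nnreal,
    ENNReal.ofReal_coe_nnreal]

lemma FR_zero (f : ℝ × ℝ → ℝ) : FR f 0 0 = 0 := by
  simp only [FR, SignedMeasure.totalVariation_zero, add_zero, lintegral_zero_measure]

/-! ### Distributional time derivatives -/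

lemma isCompact_D : IsCompact D := isCompact_Icc.prod isCompact_Icc

lemma integrable_of_continuousOn {f : ℝ × ℝ → ℝ} (hf : ContinuousOn f D) {m : Measure (ℝ × ℝ)}
    [IsFiniteMeasure m] (hm : m Dᶜ = 0) : Integrable f m := by
  have h := hf.integrableOn_compact (μ := m) isCompact_D
  rwa [IntegrableOn, Measure.restrict_eq_self_of_ae_mem (s := D) (mem_ae_iff.2 hm)]
    at h

lemma posPart_le (δ : SignedMeasure (ℝ × ℝ)) :
    δ.toJordanDecomposition.posPart ≤ δ.totalVariation := Measure.le_add_right le_rfl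

lemma negPart_le (δ : SignedMeasure (ℝ × ℝ)) :
    δ.toJordanDecomposition.negPart ≤ δ.totalVariation := Measure.le_add_left le_rfl

lemma toSignedMeasure_posPart_sub_negPart (δ : SignedMeasure (ℝ × ℝ)) :
    δ.toJordanDecomposition.posPart.toSignedMeasure -
      δ.toJordanDecomposition.negPart.toSignedMeasure = δ :=
  SignedMeasure.toSignedMeasure_toJordanDecomposition δ

/-- The integral against a signed measure may be computed with any decomposition into a
difference of finite measures. -/
lemma signedIntegral_eq_sub {δ : SignedMeasure (ℝ × ℝ)} {μ₁ μ₂ : Measure (ℝ × ℝ)}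
    [IsFiniteMeasure μ₁] [IsFiniteMeasure μ₂]
    (h : δ = μ₁.toSignedMeasure - μ₂.toSignedMeasure) {f : ℝ × ℝ → ℝ}
    (h₁ : Integrable f μ₁) (h₂ : Integrable f μ₂) (h₃ : Integrable f δ.totalVariation) :
    signedIntegral δ f = ∫ z, f z ∂μ₁ - ∫ z, f z ∂μ₂ := by
  have e : δ.toJordanDecomposition.posPart + μ₂ = μ₁ + δ.toJordanDecomposition.negPart := by
    rw [← Measure.toSignedMeasure_eq_toSignedMeasure_iff, Measure.toSignedMeasure_add,
      Measure.toSignedMeasure_add]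
    have h' := toSignedMeasure_posPart_sub_negPart δ
    rw [sub_eq_iff_eq_add] at h'
    rw [h']
    nth_rw 1 [h]
    abel
  have i₁ := h₃.mono_measure (posPart_le δ)
  have i₂ := h₃.mono_measure (negPart_le δ)
  have e' : ∫ z, f z ∂(δ.toJordanDecomposition.posPart + μ₂) =
    ∫ z, f z ∂(μ₁ + δ.toJordanDecomposition.negPart) := by rw [e]
  rw [integral_add_measure i₁ h₂, integral_add_measure h₁ i₂] at e'
  rw [signedIntegral]
  linarith

lemma IsTimeDeriv.totalVariation_compl_D {μ : Measure (ℝ × ℝ)} {δ : SignedMeasure (ℝ × ℝ)}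
    (h : IsTimeDeriv μ δ) : δ.totalVariation Dᶜ = 0 :=
  measure_mono_null (compl_subset_compl.2 (prod_mono Ioo_subset_Icc_self le_rfl)) h.1

lemma IsTimeDeriv.combination {μ μ' : Measure (ℝ × ℝ)} {δ δ' : SignedMeasure (ℝ × ℝ)}
    (hμ : μ ∈ measD) (hμ' : μ' ∈ measD) (h : IsTimeDeriv μ δ) (h' : IsTimeDeriv μ' δ')
    (a b : NNReal) : IsTimeDeriv (a • μ + b • μ') ((a : ℝ) • δ + (b : ℝ) • δ') := by
  have := hμ.1
  have := hμ'.1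
  have htv : ((a : ℝ) • δ + (b : ℝ) • δ').totalVariation (Ioo (0 : ℝ) 1 ×ˢ I01)ᶜ = 0 := by
    have hac : ((a : ℝ) • δ + (b : ℝ) • δ').totalVariation ≪
        δ.totalVariation + δ'.totalVariation :=
      totalVariation_combination_absolutelyContinuous
        (Measure.absolutelyContinuous_of_le (Measure.le_add_right le_rfl))
        (Measure.absolutelyContinuous_of_le (Measure.le_add_left le_rfl)) _ _
    exact hac (by simp [h.1, h'.1])
  refine ⟨htv, fun f g hf hg hd h0 => ?_⟩
  have e := h.2 f g hf hg hd h0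
  have e' := h'.2 f g hf hg hd h0
  have hD := h.totalVariation_compl_D
  have hD' := h'.totalVariation_compl_D
  have ip := (integrable_of_continuousOn hf hD).mono_measure (posPart_le δ)
  have im := (integrable_of_continuousOn hf hD).mono_measure (negPart_le δ)
  have ip' := (integrable_of_continuousOn hf hD').mono_measure (posPart_le δ')
  have im' := (integrable_of_continuousOn hf hD').mono_measure (negPart_le δ')
  have hD'' : ((a : ℝ) • δ + (b : ℝ) • δ').totalVariation Dᶜ = 0 :=
    measure_mono_null (compl_subset_compl.2 (prod_mono Ioo_subset_Icc_self le_rfl)) htv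
  have hdec : (a : ℝ) • δ + (b : ℝ) • δ' =
      (a • δ.toJordanDecomposition.posPart + b • δ'.toJordanDecomposition.posPart).toSignedMeasure -
      (a • δ.toJordanDecomposition.negPart +
        b • δ'.toJordanDecomposition.negPart).toSignedMeasure := by
    rw [Measure.toSignedMeasure_add, Measure.toSignedMeasure_add, Measure.toSignedMeasure_smul,
      Measure.toSignedMeasure_smul, Measure.toSignedMeasure_smul, Measure.toSignedMeasure_smul]
    nth_rw 1 [← toSignedMeasure_posPart_sub_negPart δ, ← toSignedMeasure_posPart_sub_negPart δ']
    rw [smul_sub, smul_sub]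
    simp only [← NNReal.smul_def]
    abel
  have s : ∀ (c : NNReal) {m : Measure (ℝ × ℝ)} {f : ℝ × ℝ → ℝ}, Integrable f m →
      Integrable f (c • m) := fun c m f hm => hm.smul_measure_nnreal
  rw [signedIntegral_eq_sub hdec ((s a ip).add_measure (s b ip'))
    ((s a im).add_measure (s b im')) (integrable_of_continuousOn hf hD''),
    integral_add_measure (s a ip) (s b ip'), integral_add_measure (s a im) (s b im'),
    integral_add_measure (s a (integrable_of_continuousOn hg hμ.2))
      (s b (integrable_of_continuousOn hg hμ'.2))]
  simp only [integral_smul_nnreal_measure, NNReal.smul_def, smul_eq_mul, e, e', signedIntegral]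
  ring

lemma isTimeDeriv_zero : IsTimeDeriv 0 0 := by
  refine ⟨by simp [SignedMeasure.totalVariation_zero], fun f g _ _ _ _ => ?_⟩
  simp [signedIntegral, SignedMeasure.toJordanDecomposition_zero]

/-- The indicator of an open set is a limit of smooth functions supported in that set. -/
lemma exists_contDiff_tendsto_indicator {E : Type*} [NormedAddCommGroup E] [NormedSpace ℝ E]
    [FiniteDimensional ℝ E] {s : Set E} (hs : IsOpen s) :
    ∃ f : ℕ → E → ℝ, (∀ n, ContDiff ℝ 1 (f n)) ∧ (∀ n x, 0 ≤ f n x ∧ f n x ≤ 1) ∧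
      (∀ n, ∀ x ∉ s, f n x = 0) ∧
      ∀ x, Tendsto (fun n => f n x) atTop (𝓝 (s.indicator (fun _ => 1) x)) := by
  obtain ⟨f, hsupp, hf, hr⟩ := hs.exists_contDiff_support_eq (n := 1)
  have hf01 : ∀ x, 0 ≤ f x ∧ f x ≤ 1 := fun x => hr ⟨x, rfl⟩
  refine ⟨fun n x => 1 - (1 - f x) ^ (n + 1), fun n => ?_, fun n x => ?_, fun n x hx => ?_,
    fun x => ?_⟩
  · exact contDiff_const.sub ((contDiff_const.sub hf).pow _)
  · have h1 : (1 - f x) ^ (n + 1) ≤ 1 :=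
      pow_le_one₀ (by linarith [hf01 x]) (by linarith [hf01 x])
    have h2 : 0 ≤ (1 - f x) ^ (n + 1) := pow_nonneg (by linarith [hf01 x]) _
    constructor <;> linarith
  · have : f x = 0 := by rwa [← hsupp, Function.notMem_support] at hx
    simp [this]
  · by_cases hx : x ∈ s
    · have h0 : f x ≠ 0 := by rwa [← hsupp, Function.mem_support] at hx
      have hpos : 0 < f x := lt_of_le_of_ne (hf01 x).1 h0.symm
      have := (tendsto_pow_atTop_nhds_zero_of_lt_one (r := 1 - f x) (by linarith [hf01 x])
        (by linarith)).comp (tendsto_add_atTop_nat 1)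
      simpa [hx] using this.const_sub 1
    · have h0 : f x = 0 := by rwa [← hsupp, Function.notMem_support] at hx
      simp [hx, h0]

lemma tendsto_integral_indicator {E : Type*} [TopologicalSpace E] [MeasurableSpace E]
    [BorelSpace E] {s : Set E}
    (hs : IsOpen s) {f : ℕ → E → ℝ} (hc : ∀ n, Continuous (f n))
    (hb : ∀ n x, 0 ≤ f n x ∧ f n x ≤ 1)
    (ht : ∀ x, Tendsto (fun n => f n x) atTop (𝓝 (s.indicator (fun _ => 1) x)))
    (m : Measure E) [IsFiniteMeasure m] :
    Tendsto (fun n => ∫ x, f n x ∂m) atTop (𝓝 (m.real s)) := by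
  have h := tendsto_integral_of_dominated_convergence (μ := m) (F := f)
    (f := s.indicator fun _ => 1) (fun _ => (1 : ℝ)) (fun n => (hc n).aestronglyMeasurable)
    (integrable_const _) (fun n => ae_of_all _ fun x => by
      rw [Real.norm_eq_abs, abs_of_nonneg (hb n x).1]; exact (hb n x).2) (ae_of_all _ ht)
  rwa [integral_indicator_const _ hs.measurableSet, smul_eq_mul, mul_one] at h

/-- The distributional time derivative is unique. -/
lemma IsTimeDeriv.unique {μ : Measure (ℝ × ℝ)} {δ δ' : SignedMeasure (ℝ × ℝ)}
    (h : IsTimeDeriv μ δ) (h' : IsTimeDeriv μ δ') : δ = δ' := by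
  have hopen : ∀ s : Set (ℝ × ℝ), IsOpen s → δ s = δ' s := by
    intro s hs
    -- Test functions have to vanish at the times `0` and `1`, and nothing is lost by cutting there
    -- since both signed measures live on `(0,1) × [0,1]`.
    set u : Set (ℝ × ℝ) := Ioo 0 1 ×ˢ univ with hu
    have huo : IsOpen u := isOpen_Ioo.prod isOpen_univ
    have hred : ∀ d : SignedMeasure (ℝ × ℝ), IsTimeDeriv μ d → d s = d (s ∩ u) := by
      intro d hd
      have hnull : d (s \ u) = 0 := by
        refine SignedMeasure.null_of_totalVariation_zero d (measure_mono_null ?_ hd.1)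
        rintro z ⟨_, hz⟩ hz'
        exact hz ⟨hz'.1, trivial⟩
      rw [← VectorMeasure.of_add_of_sdiff (hs.inter huo).measurableSet hs.measurableSet
        inter_subset_left, sdiff_self_inter, hnull, add_zero]
    rw [hred δ h, hred δ' h']
    obtain ⟨f, hfc, hfb, hf0, hft⟩ := exists_contDiff_tendsto_indicator (hs.inter huo)
    have hlim : ∀ d : SignedMeasure (ℝ × ℝ),
        Tendsto (fun n => signedIntegral d (f n)) atTop (𝓝 (d (s ∩ u))) := by
      intro d
      rw [SignedMeasure.apply_eq_posPart_real_sub_negPart_real d (hs.inter huo).measurableSet]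
      exact (tendsto_integral_indicator (hs.inter huo) (fun n => (hfc n).continuous) hfb hft _).sub
        (tendsto_integral_indicator (hs.inter huo) (fun n => (hfc n).continuous) hfb hft _)
    refine tendsto_nhds_unique (hlim δ) ?_
    convert hlim δ' using 2 with n
    have hd : ∀ d : SignedMeasure (ℝ × ℝ), IsTimeDeriv μ d →
        ∫ z, fderiv ℝ (f n) z (1, 0) ∂μ = - signedIntegral d (f n) := by
      intro d hd
      refine hd.2 (f n) _ (hfc n).continuous.continuousOn ?_ ?_ ?_
      · exact (((hfc n).continuous_fderiv one_ne_zero).clm_apply continuous_const).continuousOn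
      · intro t _ x _
        have h1 : HasFDerivAt (f n) (fderiv ℝ (f n) (t, x)) (t, x) :=
          ((hfc n).differentiable one_ne_zero _).hasFDerivAt
        exact (h1.comp_hasDerivAt t
          ((hasDerivAt_id t).prodMk (hasDerivAt_const t x))).hasDerivWithinAt
      · intro x _
        constructor <;> exact hf0 n _ (by simp [hu])
    linarith [hd δ h, hd δ' h']
  refine VectorMeasure.ext_of_generateFrom {s | IsOpen s} hopen ?_ isPiSystem_isOpen
    (hopen _ isOpen_univ)
  exact BorelSpace.measurable_eq

/-- If `∂_t μ` is a measure, then the time marginal of `μ` has a bounded density: testing with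
primitives of functions `g` of time gives `|∫ g dμ| ≤ K ∫₀¹ |g|`. -/
lemma IsTimeDeriv.exists_map_fst_le {μ : Measure (ℝ × ℝ)} {δ : SignedMeasure (ℝ × ℝ)}
    (hμ : μ ∈ measD) (h : IsTimeDeriv μ δ) :
    ∃ K : NNReal, μ.map Prod.fst ≤ K • volume.restrict I01 := by
  have := hμ.1
  set V : ℝ := δ.toJordanDecomposition.posPart.real univ +
    δ.toJordanDecomposition.negPart.real univ with hV
  have hV0 : 0 ≤ V := by positivity
  have hD := h.totalVariation_compl_D
  have key : ∀ g : ℝ → ℝ, Continuous g → ∫ z, g z.1 ∂μ ≤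
      (μ.real univ + 2 * V) * ∫ t in I01, |g t| := by
    intro g hg
    set N := ∫ t in I01, |g t| with hN
    have hNi : N = ∫ t in (0 : ℝ)..1, |g t| := by
      rw [hN, intervalIntegral.integral_of_le zero_le_one, integral_Icc_eq_integral_Ioc]
    set c := ∫ t in (0 : ℝ)..1, g t with hc
    have hcN : |c| ≤ N := by
      rw [hNi]; exact intervalIntegral.abs_integral_le_integral_abs zero_le_one
    have hN0 : 0 ≤ N := (abs_nonneg _).trans hcN
    have hgc : Continuous fun t => g t - c := hg.sub continuous_const
    -- The mean `c` is subtracted so that the primitive vanishes at time `1` too.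
    set G : ℝ → ℝ := fun t => ∫ s in (0 : ℝ)..t, (g s - c) with hG
    have hGd : ∀ t, HasDerivAt G (g t - c) t := fun t => hgc.integral_hasStrictDerivAt 0 t
      |>.hasDerivAt
    have hGc : Continuous G := continuous_iff_continuousAt.2 fun t => (hGd t).continuousAt
    have hGN : ∀ t ∈ I01, |G t| ≤ 2 * N := by
      intro t ht
      have e : G t = (∫ s in (0 : ℝ)..t, g s) - t * c := by
        rw [hG]
        dsimp only
        rw [intervalIntegral.integral_sub (hg.intervalIntegrable _ _)
          (intervalIntegrable_const), intervalIntegral.integral_const]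
        simp
      have b1 : |∫ s in (0 : ℝ)..t, g s| ≤ N := by
        rw [hNi]
        refine (intervalIntegral.abs_integral_le_integral_abs ht.1).trans ?_
        exact intervalIntegral.integral_mono_interval le_rfl ht.1 ht.2
          (ae_of_all _ fun _ => abs_nonneg _) (hg.abs.intervalIntegrable _ _)
      have b2 : |t * c| ≤ N := by
        rw [abs_mul, abs_of_nonneg ht.1]
        nlinarith [ht.1, ht.2, abs_nonneg c]
      rw [e]
      exact (abs_sub _ _).trans (by linarith)
    have e := h.2 (fun z => G z.1) (fun z => g z.1 - c) (hGc.comp continuous_fst).continuousOn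
      (hgc.comp continuous_fst).continuousOn (fun t _ x _ => (hGd t).hasDerivWithinAt)
      (fun x _ => ⟨by simp [hG], by
        simp only [hG]
        rw [intervalIntegral.integral_sub (hg.intervalIntegrable _ _)
          (intervalIntegrable_const), intervalIntegral.integral_const, ← hc]
        simp⟩)
    have hgi : Integrable (fun z : ℝ × ℝ => g z.1) μ :=
      integrable_of_continuousOn (hg.comp continuous_fst).continuousOn hμ.2
    rw [integral_sub hgi
      (integrable_const _), integral_const, smul_eq_mul] at e
    have b : ∀ m : Measure (ℝ × ℝ), IsFiniteMeasure m → m ≤ δ.totalVariation →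
        |∫ z, G z.1 ∂m| ≤ 2 * N * m.real univ := by
      intro m hfm hm
      have hmD : m Dᶜ = 0 := le_antisymm ((hm _).trans hD.le) zero_le
      refine norm_integral_le_of_norm_le_const (μ := m) (f := fun z : ℝ × ℝ => G z.1) ?_
      filter_upwards [compl_mem_ae_iff.2 hmD] with z hz
      exact hGN _ (not_not.1 hz).1
    have b1 := abs_le.1 (b _ inferInstance (posPart_le δ))
    have b2 := abs_le.1 (b _ inferInstance (negPart_le δ))
    have b3 : μ.real univ * c ≤ μ.real univ * N :=
      mul_le_mul_of_nonneg_left ((le_abs_self c).trans hcN) measureReal_nonneg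
    rw [signedIntegral] at e
    have : (μ.real univ + 2 * V) * N = μ.real univ * N +
      (2 * N * δ.toJordanDecomposition.posPart.real univ +
        2 * N * δ.toJordanDecomposition.negPart.real univ) := by rw [hV]; ring
    linarith [b1.1, b2.2]
  refine ⟨⟨μ.real univ + 2 * V, by positivity⟩, ?_⟩
  set K : NNReal := ⟨μ.real univ + 2 * V, by positivity⟩ with hK
  have hKr : (K : ℝ) = μ.real univ + 2 * V := rfl
  have hmapf : IsFiniteMeasure (μ.map Prod.fst) := inferInstance
  have hopen : ∀ s : Set ℝ, IsOpen s →
      μ.map Prod.fst s ≤ (K • (volume : Measure ℝ).restrict I01) s := by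
    intro s hs
    obtain ⟨f, hfc, hfb, hf0, hft⟩ := exists_contDiff_tendsto_indicator hs
    have l1 := tendsto_integral_indicator hs (fun n => (hfc n).continuous) hfb hft (μ.map Prod.fst)
    have l2 := tendsto_integral_indicator hs (fun n => (hfc n).continuous) hfb hft
      ((volume : Measure ℝ).restrict I01)
    have hle : (μ.map Prod.fst).real s ≤ K * ((volume : Measure ℝ).restrict I01).real s := by
      refine le_of_tendsto_of_tendsto' l1 (l2.const_mul (K : ℝ)) fun n => ?_
      rw [integral_map measurable_fst.aemeasurable (hfc n).continuous.aestronglyMeasurable]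
      have := key (f n) (hfc n).continuous
      simp only [abs_of_nonneg (hfb n _).1] at this
      exact this
    have e2 : ((K • (volume : Measure ℝ).restrict I01) s).toReal =
        K * ((volume : Measure ℝ).restrict I01).real s := by
      rw [Measure.smul_apply, ENNReal.smul_def, smul_eq_mul, ENNReal.toReal_mul]; rfl
    rw [← ENNReal.toReal_le_toReal (measure_ne_top _ _) (measure_ne_top _ _), e2]
    exact hle
  refine Measure.le_iff.2 fun A _ => ?_
  rw [A.measure_eq_iInf_isOpen (K • (volume : Measure ℝ).restrict I01)]
  exact le_iInf fun U => le_iInf fun hAU => le_iInf fun hU =>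
    (measure_mono hAU).trans (hopen U hU)

/-! ### Elements of `L²([0,1])` -/

instance isProbabilityMeasure_restrict_I01 :
    IsProbabilityMeasure ((volume : Measure ℝ).restrict I01) := ⟨by simp⟩

lemma ae_I01_of_ae_Ioo {P : ℝ → Prop} (h : ∀ᵐ x, x ∈ Ioo (0 : ℝ) 1 → P x) :
    ∀ᵐ x ∂(volume.restrict I01), P x := by
  rwa [← restrict_Ioo_eq_restrict_Icc, ae_restrict_iff' measurableSet_Ioo]

lemma integrableOn_L2 (q : L2) : IntegrableOn q I01 := (Lp.memLp q).integrable one_le_two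

lemma integral_abs_le_norm (q : L2) : ∫ x in I01, |q x| ≤ ‖q‖ := by
  have h := integral_norm_eq_lintegral_enorm (μ := volume.restrict I01) (f := q)
    (Lp.aestronglyMeasurable q)
  simp only [Real.norm_eq_abs] at h
  rw [h, Lp.norm_def]
  refine ENNReal.toReal_mono (Lp.eLpNorm_ne_top q) ?_
  rw [← eLpNorm_one_eq_lintegral_enorm]
  exact eLpNorm_le_eLpNorm_of_exponent_le one_le_two (Lp.aestronglyMeasurable q)

lemma integral_sq_eq_norm_sq (q : L2) : ∫ x in I01, q x ^ 2 = ‖q‖ ^ 2 := by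
  have h : inner ℝ q q = ‖q‖ ^ 2 := real_inner_self_eq_norm_sq q
  rw [← h, MeasureTheory.L2.inner_def]
  refine integral_congr_ae (ae_of_all _ fun x => ?_)
  simp [sq]

/-- Integrals up to `x` as integrals over the fixed domain `[0,1]`, where joint measurability and
Fubini's theorem apply directly. -/
lemma intervalIntegral_eq_setIntegral {x : ℝ} (hx : x ∈ I01) (f : ℝ → ℝ) :
    ∫ u in (0 : ℝ)..x, f u = ∫ u in I01, (Iic x).indicator f u := by
  rw [setIntegral_indicator measurableSet_Iic, intervalIntegral.integral_of_le hx.1,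
    ← integral_Icc_eq_integral_Ioc]
  congr 2
  ext u
  simp only [mem_Icc, mem_inter_iff, mem_Iic]
  constructor
  · intro h; exact ⟨⟨h.1, h.2.trans hx.2⟩, h.2⟩
  · intro h; exact ⟨h.1.1, h.2⟩

lemma intervalIntegral_one_eq (f : ℝ → ℝ) : ∫ u in (0 : ℝ)..1, f u = ∫ u in I01, f u := by
  rw [intervalIntegral.integral_of_le zero_le_one, ← integral_Icc_eq_integral_Ioc]

lemma intervalIntegral_congr_ae {f g : ℝ → ℝ} (h : f =ᵐ[volume.restrict I01] g) {a b : ℝ}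
    (ha : a ∈ I01) (hb : b ∈ I01) : ∫ u in a..b, f u = ∫ u in a..b, g u := by
  refine intervalIntegral.integral_congr_ae_restrict ?_
  refine ae_restrict_of_ae_restrict_of_subset ?_ h
  exact uIoc_subset_uIcc.trans (uIcc_subset_Icc ha hb)

lemma abs_intervalIntegral_le {f : ℝ → ℝ} (hf : IntegrableOn f I01) {x : ℝ} (hx : x ∈ I01) :
    |∫ u in (0 : ℝ)..x, f u| ≤ ∫ u in I01, |f u| := by
  rw [intervalIntegral_eq_setIntegral hx]
  refine abs_integral_le_integral_abs.trans ?_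
  refine integral_mono (hf.indicator measurableSet_Iic).abs hf.abs fun u => ?_
  by_cases hu : u ∈ Iic x <;> simp [hu]

/-- The clamping of the line onto `[0,1]`. -/
def clamp (x : ℝ) : ℝ := projIcc (0 : ℝ) 1 zero_le_one x

lemma clamp_mem (x : ℝ) : clamp x ∈ I01 := (projIcc (0 : ℝ) 1 zero_le_one x).2

lemma clamp_of_mem {x : ℝ} (hx : x ∈ I01) : clamp x = x := by
  rw [clamp, projIcc_of_mem zero_le_one hx]

lemma continuous_clamp : Continuous clamp := continuous_subtype_val.comp continuous_projIcc

/-- The primitive `∫₀ˣ q`, made globally continuous by clamping `x`. -/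
def prim (q : L2) (x : ℝ) : ℝ := ∫ u in (0 : ℝ)..clamp x, q u

lemma prim_of_mem (q : L2) {x : ℝ} (hx : x ∈ I01) : prim q x = ∫ u in (0 : ℝ)..x, q u := by
  rw [prim, clamp_of_mem hx]

lemma prim_sub (q q' : L2) (x : ℝ) : prim (q - q') x = prim q x - prim q' x := by
  rw [prim, prim, prim, intervalIntegral_congr_ae (Lp.coeFn_sub q q') (by simp) (clamp_mem x)]
  refine intervalIntegral.integral_sub ?_ ?_ <;>
  · rw [intervalIntegrable_iff_integrableOn_Icc_of_le (clamp_mem x).1]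
    exact (integrableOn_L2 _).mono_set (Icc_subset_Icc_right (clamp_mem x).2)

lemma abs_prim_le (q : L2) (x : ℝ) : |prim q x| ≤ ‖q‖ :=
  (abs_intervalIntegral_le (integrableOn_L2 q) (clamp_mem x)).trans (integral_abs_le_norm q)

lemma continuous_prim : Continuous (Function.uncurry prim) := by
  refine continuous_prod_of_continuous_lipschitzWith _ 1 (fun q => ?_) fun x => ?_
  · have h : ContinuousOn (fun x => ∫ u in (0 : ℝ)..x, q u) I01 := by
      have := intervalIntegral.continuousOn_primitive_interval (a := 0) (b := 1) (f := q)
        (μ := volume) (by rw [uIcc_of_le zero_le_one]; exact integrableOn_L2 q)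
      rwa [uIcc_of_le zero_le_one] at this
    exact h.comp_continuous continuous_clamp clamp_mem
  · refine LipschitzWith.of_dist_le_mul fun q q' => ?_
    rw [Real.dist_eq, dist_eq_norm, NNReal.coe_one, one_mul]
    change |prim q x - prim q' x| ≤ _
    rw [← prim_sub]
    exact abs_prim_le _ _

/-- `L²([0,1])` carries its Borel σ-algebra. -/
instance : MeasurableSpace L2 := borel L2

instance : BorelSpace L2 := ⟨rfl⟩

/-- The density `η(q)`, extended to a continuous function on `L² × ℝ`. -/
def etaC (q : L2) (x : ℝ) : ℝ := Real.exp (prim q x)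

lemma continuous_etaC : Continuous (Function.uncurry etaC) :=
  Real.continuous_exp.comp continuous_prim

lemma eta_eq (q : L2) {x : ℝ} (hx : x ∈ I01) : eta q x = etaC q x := by
  rw [eta, etaC, prim_of_mem q hx]

lemma etaC_pos (q : L2) (x : ℝ) : 0 < etaC q x := Real.exp_pos _

lemma etaC_le (q : L2) (x : ℝ) : etaC q x ≤ Real.exp ‖q‖ :=
  Real.exp_le_exp.2 ((le_abs_self _).trans (abs_prim_le q x))

/-- A jointly measurable choice of the values of the elements of `L²([0,1])`. -/
def ev (z : L2 × ℝ) : ℝ := deriv (prim z.1) z.2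

lemma measurable_ev : Measurable ev := measurable_deriv_with_param continuous_prim

lemma ev_ae_eq (q : L2) : ∀ᵐ x ∂(volume.restrict I01), ev (q, x) = q x := by
  have hi : IntervalIntegrable q volume 0 1 := by
    rw [intervalIntegrable_iff_integrableOn_Icc_of_le zero_le_one]
    exact integrableOn_L2 q
  refine ae_I01_of_ae_Ioo ?_
  filter_upwards [hi.ae_hasDerivAt_integral] with x hx hx01
  have h := hx (by rw [uIcc_of_le zero_le_one]; exact Ioo_subset_Icc_self hx01) 0 (by simp)
  refine HasDerivAt.deriv (h.congr_of_eventuallyEq ?_)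
  filter_upwards [Ioo_mem_nhds hx01.1 hx01.2] with y hy
  exact prim_of_mem q (Ioo_subset_Icc_self hy)

/-! ### Regularity of paths -/

lemma HasH1Deriv.intervalIntegrable {u v : ℝ → L2} (h : HasH1Deriv u v) {s t : ℝ} (hs : s ∈ I01)
    (ht : t ∈ I01) : IntervalIntegrable v volume s t := by
  have hv : IntegrableOn v I01 := h.1.integrable one_le_two
  exact (hv.mono_set (uIcc_subset_Icc hs ht)).intervalIntegrable

lemma HasH1Deriv.norm_sub_le {u v : ℝ → L2} (h : HasH1Deriv u v) {s t : ℝ} (hs : s ∈ I01)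
    (ht : t ∈ I01) (hst : s ≤ t) : ‖u t - u s‖ ≤ ∫ r in s..t, ‖v r‖ := by
  rw [h.2 t ht, h.2 s hs, add_sub_add_left_eq_sub, intervalIntegral.integral_interval_sub_left
    (h.intervalIntegrable (by simp) ht) (h.intervalIntegrable (by simp) hs)]
  exact intervalIntegral.norm_integral_le_integral_norm hst

lemma HasH1Deriv.continuousOn {u v : ℝ → L2} (h : HasH1Deriv u v) : ContinuousOn u I01 := by
  have hv : IntegrableOn v I01 := h.1.integrable one_le_two
  have hc := intervalIntegral.continuousOn_primitive_interval (a := 0) (b := 1) (f := v)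
    (μ := volume) (by rwa [uIcc_of_le zero_le_one])
  rw [uIcc_of_le zero_le_one] at hc
  exact (continuousOn_const.add hc).congr fun t ht => h.2 t ht

lemma abs_exp_neg_sub_le {a b M : ℝ} (ha : |a| ≤ M) (hb : |b| ≤ M) :
    |Real.exp (-a) - Real.exp (-b)| ≤ Real.exp M * |a - b| := by
  have key : ∀ a b : ℝ, |a| ≤ M → Real.exp (-a) - Real.exp (-b) ≤ Real.exp M * |a - b| := by
    intro a b ha
    have h1 : Real.exp (-b) = Real.exp (-a) * Real.exp (a - b) := by
      rw [← Real.exp_add]; ring_nf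
    have h2 := Real.add_one_le_exp (a - b)
    have h3 : Real.exp (-a) ≤ Real.exp M :=
      Real.exp_le_exp.2 (by linarith [neg_abs_le a])
    have h4 := Real.exp_pos (-a)
    have h5 : -(a - b) ≤ |a - b| := neg_le_abs _
    calc Real.exp (-a) - Real.exp (-b) ≤ Real.exp (-a) * -(a - b) := by rw [h1]; nlinarith
      _ ≤ Real.exp (-a) * |a - b| := by gcongr
      _ ≤ _ := by gcongr
  refine abs_sub_le_iff.2 ⟨key a b ha, ?_⟩
  rw [abs_sub_comm]
  exact key b a hb

/-- Along `q̇ = η(q) p`, the momentum `p = q̇ / η(q)` is Lipschitz in `(q, q̇)` on bounded sets. -/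
lemma norm_momentum_sub_le {q q' v v' p p' : L2} {M : ℝ} (hq : ‖q‖ ≤ M) (hq' : ‖q'‖ ≤ M)
    (h : ∀ᵐ x ∂(volume.restrict I01), v x = eta q x * p x)
    (h' : ∀ᵐ x ∂(volume.restrict I01), v' x = eta q' x * p' x) :
    ‖p - p'‖ ≤ Real.exp M * (‖v - v'‖ + ‖q - q'‖ * ‖v'‖) := by
  have hle : ‖p - p'‖ ≤ ‖Real.exp M • |v - v'| + (Real.exp M * ‖q - q'‖) • |v'|‖ := by
    refine Lp.norm_le_norm_of_ae_le ?_
    filter_upwards [h, h', Lp.coeFn_sub p p', Lp.coeFn_sub v v', Lp.coeFn_abs (v - v'),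
      Lp.coeFn_abs v', Lp.coeFn_smul (Real.exp M) |v - v'|,
      Lp.coeFn_smul (Real.exp M * ‖q - q'‖) |v'|,
      Lp.coeFn_add (Real.exp M • |v - v'|) ((Real.exp M * ‖q - q'‖) • |v'|),
      ae_restrict_mem measurableSet_Icc] with x e e' e1 e2 e3 e4 e5 e6 e7 hx
    rw [e1, e7, Pi.add_apply, e5, e6, Pi.smul_apply, Pi.smul_apply, e3, e4, e2, Pi.sub_apply,
      Pi.sub_apply, smul_eq_mul, smul_eq_mul]
    have f1 : ∀ (q p v : L2), v x = eta q x * p x → p x = Real.exp (-prim q x) * v x := by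
      intro q p v e
      rw [e, eta_eq q hx, etaC, ← mul_assoc, ← Real.exp_add]
      simp
    rw [f1 q p v e, f1 q' p' v' e']
    have b1 : Real.exp (-prim q x) ≤ Real.exp M :=
      Real.exp_le_exp.2 (by linarith [neg_abs_le (prim q x), abs_prim_le q x])
    have b2 : |Real.exp (-prim q x) - Real.exp (-prim q' x)| ≤ Real.exp M * ‖q - q'‖ := by
      refine (abs_exp_neg_sub_le ((abs_prim_le q x).trans hq) ((abs_prim_le q' x).trans hq')).trans
        ?_
      rw [← prim_sub]
      gcongr
      exact abs_prim_le _ _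
    have e8 : Real.exp (-prim q x) * v x - Real.exp (-prim q' x) * v' x =
        Real.exp (-prim q x) * (v x - v' x) +
          (Real.exp (-prim q x) - Real.exp (-prim q' x)) * v' x := by ring
    rw [e8, Real.norm_eq_abs, Real.norm_eq_abs]
    refine (abs_add_le _ _).trans ((?_ : _ ≤ _).trans (le_abs_self _))
    rw [abs_mul, abs_mul, abs_of_pos (Real.exp_pos _)]
    gcongr
  refine hle.trans ((norm_add_le _ _).trans (le_of_eq ?_))
  rw [norm_smul, norm_smul, norm_abs_eq_norm, norm_abs_eq_norm, Real.norm_eq_abs, Real.norm_eq_abs,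
    abs_of_pos (Real.exp_pos M), abs_of_nonneg (by positivity)]
  ring

lemma exists_norm_le_of_continuousOn {u : ℝ → L2} (h : ContinuousOn u I01) :
    ∃ M, ∀ t ∈ I01, ‖u t‖ ≤ M := isCompact_Icc.exists_bound_of_continuousOn h

lemma continuousOn_q {p₀ q₀ : L2} {p q : ℝ → L2} (hpq : (p, q) ∈ pathSet p₀ q₀) :
    ContinuousOn q I01 := by
  obtain ⟨⟨v, a, hq, _⟩, _⟩ := hpq
  exact hq.continuousOn

/-- The momentum is absolutely continuous in time, with a square integrable speed bound. -/
lemma exists_momentum_bound {p₀ q₀ : L2} {p q : ℝ → L2} (hpq : (p, q) ∈ pathSet p₀ q₀) :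
    ∃ G : ℝ → ℝ, MemLp G 2 (volume.restrict I01) ∧
      ∀ s ∈ I01, ∀ t ∈ I01, s ≤ t → ‖p t - p s‖ ≤ ∫ r in s..t, G r := by
  obtain ⟨⟨v, a, hq, hv, hpv⟩, _⟩ := hpq
  obtain ⟨M, hM⟩ := exists_norm_le_of_continuousOn hq.continuousOn
  obtain ⟨V, hV⟩ := exists_norm_le_of_continuousOn hv.continuousOn
  refine ⟨fun r => Real.exp M * (‖a r‖ + ‖v r‖ * V),
    ((hv.1.norm).add (hq.1.norm.mul_const V)).const_mul _, fun s hs t ht hst => ?_⟩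
  refine (norm_momentum_sub_le (hM t ht) (hM s hs) (hpv t ht) (hpv s hs)).trans ?_
  have i1 := (hv.intervalIntegrable hs ht).norm
  have i2 := (hq.intervalIntegrable hs ht).norm
  rw [intervalIntegral.integral_const_mul, intervalIntegral.integral_add i1 (i2.mul_const V),
    intervalIntegral.integral_mul_const]
  have h1 := hv.norm_sub_le hs ht hst
  have h2 := hq.norm_sub_le hs ht hst
  have h3 := hV s hs
  gcongr
  exact intervalIntegral.integral_nonneg hst fun _ _ => norm_nonneg _

lemma continuousOn_p {p₀ q₀ : L2} {p q : ℝ → L2} (hpq : (p, q) ∈ pathSet p₀ q₀) :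
    ContinuousOn p I01 := by
  obtain ⟨G, hG, hp⟩ := exists_momentum_bound hpq
  have hGi : IntegrableOn G I01 := hG.integrable one_le_two
  have hc := intervalIntegral.continuousOn_primitive_interval (a := 0) (b := 1) (f := G)
    (μ := volume) (by rwa [uIcc_of_le zero_le_one])
  rw [uIcc_of_le zero_le_one] at hc
  have hint : ∀ s ∈ I01, ∀ t ∈ I01, IntervalIntegrable G volume s t := fun s hs t ht =>
    (hGi.mono_set (uIcc_subset_Icc hs ht)).intervalIntegrable
  have hsub : ∀ s ∈ I01, ∀ t ∈ I01,
      ‖p t - p s‖ ≤ |(∫ r in (0 : ℝ)..t, G r) - ∫ r in (0 : ℝ)..s, G r| := by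
    intro s hs t ht
    rcases le_total s t with hst | hst
    · rw [intervalIntegral.integral_interval_sub_left (hint 0 (by simp) t ht)
        (hint 0 (by simp) s hs)]
      exact (hp s hs t ht hst).trans (le_abs_self _)
    · rw [norm_sub_rev, abs_sub_comm,
        intervalIntegral.integral_interval_sub_left (hint 0 (by simp) s hs)
        (hint 0 (by simp) t ht)]
      exact (hp t ht s hs hst).trans (le_abs_self _)
  intro s hs
  have h0 := ((hc s hs).sub_const (∫ r in (0 : ℝ)..s, G r)).abs
  simp only [sub_self, abs_zero] at h0
  refine tendsto_iff_norm_sub_tendsto_zero.2 ?_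
  refine squeeze_zero' (Eventually.of_forall fun _ => norm_nonneg _) ?_ h0
  filter_upwards [self_mem_nhdsWithin] with t ht using hsub s hs t ht

/-- The norm of `ṗ` is square integrable. Differentiability almost everywhere is not needed: where
`p` is not differentiable, `deriv p` is zero, which satisfies the bound as well. -/
lemma integrable_norm_deriv_sq {p₀ q₀ : L2} {p q : ℝ → L2} (hpq : (p, q) ∈ pathSet p₀ q₀) :
    IntegrableOn (fun t => ‖deriv p t‖ ^ 2) I01 := by
  obtain ⟨G, hG, hp⟩ := exists_momentum_bound hpq
  have hGi : IntegrableOn G I01 := hG.integrable one_le_two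
  have hint : ∀ s ∈ I01, ∀ t ∈ I01, IntervalIntegrable G volume s t := fun s hs t ht =>
    (hGi.mono_set (uIcc_subset_Icc hs ht)).intervalIntegrable
  have hbound : ∀ᵐ t ∂(volume.restrict I01), ‖deriv p t‖ ≤ |G t| := by
    refine ae_I01_of_ae_Ioo ?_
    filter_upwards [(hint 0 (by simp) 1 (by simp)).ae_hasDerivAt_integral] with t ht ht01
    have ht01' : t ∈ I01 := Ioo_subset_Icc_self ht01
    have hΓ := ht (by rwa [uIcc_of_le zero_le_one]) 0 (by simp)
    by_cases hd : DifferentiableAt ℝ p t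
    · have h1 := (hasDerivAt_iff_tendsto_slope.1 hd.hasDerivAt).norm
      have h2 := (hasDerivAt_iff_tendsto_slope.1 hΓ).abs
      refine le_of_tendsto_of_tendsto h1 h2 ?_
      filter_upwards [nhdsWithin_le_nhds (Ioo_mem_nhds ht01.1 ht01.2)] with s hs01
      have hs : s ∈ I01 := Ioo_subset_Icc_self hs01
      rw [slope, slope, vsub_eq_sub, vsub_eq_sub, norm_smul, smul_eq_mul, abs_mul,
        Real.norm_eq_abs]
      refine mul_le_mul_of_nonneg_left ?_ (abs_nonneg _)
      rcases le_total s t with hst | hst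
      · rw [norm_sub_rev, abs_sub_comm,
          intervalIntegral.integral_interval_sub_left (hint 0 (by simp) t ht01')
          (hint 0 (by simp) s hs)]
        exact (hp s hs t ht01' hst).trans (le_abs_self _)
      · rw [intervalIntegral.integral_interval_sub_left (hint 0 (by simp) s hs)
          (hint 0 (by simp) t ht01')]
        exact (hp t ht01' s hs hst).trans (le_abs_self _)
    · rw [deriv_zero_of_not_differentiableAt hd, norm_zero]
      exact abs_nonneg _
  refine hG.integrable_sq.mono'
    ((stronglyMeasurable_deriv p).norm.pow 2).aestronglyMeasurable ?_
  filter_upwards [hbound] with t ht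
  rw [Real.norm_eq_abs, abs_of_nonneg (by positivity), ← sq_abs (G t)]
  gcongr

/-! ### The orthogonal projection onto the cotangent space -/

/-- The diffeomorphism `φ(q)`, extended to a continuous function on `L² × ℝ`. -/
def phiC (q : L2) (x : ℝ) : ℝ := ∫ y in (0 : ℝ)..clamp x, etaC q y

lemma continuous_phiC : Continuous (Function.uncurry phiC) :=
  intervalIntegral.continuous_parametric_intervalIntegral_of_continuous
    (f := fun (z : L2 × ℝ) y => etaC z.1 y) (s := fun z : L2 × ℝ => clamp z.2)
    (continuous_etaC.comp ((continuous_fst.comp continuous_fst).prodMk continuous_snd))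
    (continuous_clamp.comp continuous_snd)

lemma continuous_etaC_right (q : L2) : Continuous (etaC q) :=
  continuous_etaC.comp (continuous_const.prodMk continuous_id)

lemma continuous_phiC_right (q : L2) : Continuous (phiC q) :=
  continuous_phiC.comp (continuous_const.prodMk continuous_id)

lemma phi_eq (q : L2) {x : ℝ} (hx : x ∈ I01) : phi q x = phiC q x := by
  rw [phi, phiC, clamp_of_mem hx]
  refine intervalIntegral.integral_congr fun y hy => eta_eq q ?_
  exact uIcc_subset_Icc (by simp) hx hy

lemma integral_etaC {q : L2} (hq : q ∈ Q) : ∫ x in I01, etaC q x = 1 := by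
  rw [← hq.2, intervalIntegral_one_eq]
  exact setIntegral_congr_fun measurableSet_Icc fun x hx => (eta_eq q hx).symm

/-- The change of variables `y = φ(q)(x)`. -/
lemma integral_etaC_mul_phiC_pow {q : L2} (hq : q ∈ Q) (n : ℕ) :
    ∫ x in I01, etaC q x * phiC q x ^ n = 1 / (n + 1) := by
  have hΦ : ∀ x, HasDerivAt (fun x => ∫ y in (0 : ℝ)..x, etaC q y) (etaC q x) x := fun x =>
    ((continuous_etaC_right q).integral_hasStrictDerivAt 0 x).hasDerivAt
  have h := intervalIntegral.integral_eq_sub_of_hasDerivAt (a := 0) (b := 1)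
    (f := fun x => (∫ y in (0 : ℝ)..x, etaC q y) ^ (n + 1) / (n + 1))
    (f' := fun x => etaC q x * (∫ y in (0 : ℝ)..x, etaC q y) ^ n) (fun x _ => by
      have : (n : ℝ) + 1 ≠ 0 := by positivity
      refine (((hΦ x).fun_pow (n + 1)).div_const ((n : ℝ) + 1)).congr_deriv ?_
      rw [Nat.add_sub_cancel]
      push_cast
      field_simp) (by
      refine Continuous.intervalIntegrable ?_ _ _
      refine (continuous_etaC_right q).mul (Continuous.pow ?_ n)
      exact continuous_iff_continuousAt.2 fun x => (hΦ x).continuousAt)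
  rw [intervalIntegral.integral_same, intervalIntegral_one_eq, intervalIntegral_one_eq,
    integral_etaC hq] at h
  rw [one_pow, zero_pow (Nat.succ_ne_zero n), zero_div, sub_zero] at h
  rw [← h]
  refine setIntegral_congr_fun measurableSet_Icc fun x hx => ?_
  simp only [phiC, clamp_of_mem hx]

/-- The pairing of a covector with the constant function `1`. -/
def mom0 (q : L2) (g : ℝ → ℝ) : ℝ := ∫ x in I01, etaC q x * g x

/-- The pairing of a covector with `φ(q)`. -/
def mom1 (q : L2) (g : ℝ → ℝ) : ℝ := ∫ x in I01, etaC q x * phiC q x * g x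

/-- The projection `π*_q` with the inverse of the Hilbert matrix written out. -/
def pr (q : L2) (g : ℝ → ℝ) (x : ℝ) : ℝ :=
  g x - ((4 * mom0 q g - 6 * mom1 q g) + (12 * mom1 q g - 6 * mom0 q g) * phiC q x)

lemma inv_H2 : H2⁻¹ = !![4, -6; -6, 12] := by
  refine Matrix.inv_eq_right_inv ?_
  ext i j
  fin_cases i <;> fin_cases j <;> norm_num [H2, Matrix.mul_apply, Fin.sum_univ_two]

lemma projStar_eq (q : L2) (g : ℝ → ℝ) {x : ℝ} (hx : x ∈ I01) : projStar q g x = pr q g x := by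
  have h0 : cometric q g (fun _ => 1) = mom0 q g := by
    rw [cometric, intervalIntegral_one_eq, mom0]
    refine setIntegral_congr_fun measurableSet_Icc fun y hy => ?_
    simp only [eta_eq q hy, mul_one]
  have h1 : cometric q g (phi q) = mom1 q g := by
    rw [cometric, intervalIntegral_one_eq, mom1]
    refine setIntegral_congr_fun measurableSet_Icc fun y hy => ?_
    simp only [eta_eq q hy, phi_eq q hy]
    ring
  rw [projStar, h0, h1, inv_H2, pr, phi_eq q hx]
  simp [Matrix.mulVec, dotProduct, Fin.sum_univ_two]
  ring

/-- The metric identifies the projections onto the tangent and the cotangent space. -/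
lemma proj_eta_mul (q : L2) (g : ℝ → ℝ) (x : ℝ) :
    proj q (fun y => eta q y * g y) x = eta q x * projStar q g x := by
  have hne : ∀ y, eta q y ≠ 0 := fun y => (Real.exp_pos _).ne'
  have h0 : metric q (fun y => eta q y * g y) (eta q) = cometric q g (fun _ => 1) := by
    rw [metric, cometric]
    congr 1
    ext y
    field_simp [hne y]
  have h1 : metric q (fun y => eta q y * g y) (fun y => phi q y * eta q y) =
      cometric q g (phi q) := by
    rw [metric, cometric]
    congr 1
    ext y
    field_simp [hne y]
  rw [proj, projStar, h0, h1, inv_H2]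
  simp [Matrix.mulVec, dotProduct, Fin.sum_univ_two]
  ring

lemma integral_combination {f₁ f₂ f₃ : ℝ → ℝ} (h₁ : IntegrableOn f₁ I01)
    (h₂ : IntegrableOn f₂ I01) (h₃ : IntegrableOn f₃ I01) (a b c : ℝ) :
    ∫ x in I01, (a * f₁ x + b * f₂ x + c * f₃ x) =
      a * (∫ x in I01, f₁ x) + b * (∫ x in I01, f₂ x) + c * ∫ x in I01, f₃ x := by
  have h12 : IntegrableOn (fun x => a * f₁ x + b * f₂ x) I01 :=
    (h₁.const_mul a).add (h₂.const_mul b)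
  rw [integral_add h12 (h₃.const_mul c), integral_add (h₁.const_mul a) (h₂.const_mul b),
    integral_const_mul, integral_const_mul, integral_const_mul]

lemma mom0_congr (q : L2) {g h : ℝ → ℝ} (e : g =ᵐ[volume.restrict I01] h) :
    mom0 q g = mom0 q h :=
  integral_congr_ae (by filter_upwards [e] with x hx; rw [hx])

lemma mom1_congr (q : L2) {g h : ℝ → ℝ} (e : g =ᵐ[volume.restrict I01] h) :
    mom1 q g = mom1 q h :=
  integral_congr_ae (by filter_upwards [e] with x hx; rw [hx])

lemma pr_congr (q : L2) {g h : ℝ → ℝ} (e : g =ᵐ[volume.restrict I01] h) :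
    pr q g =ᵐ[volume.restrict I01] pr q h := by
  filter_upwards [e] with x hx
  rw [pr, pr, mom0_congr q e, mom1_congr q e, hx]

lemma integrableOn_continuous_mul {c g : ℝ → ℝ} (hc : Continuous c) (hg : IntegrableOn g I01) :
    IntegrableOn (fun x => c x * g x) I01 :=
  hg.continuousOn_mul hc.continuousOn isCompact_Icc

lemma memLp_of_continuous {c : ℝ → ℝ} (hc : Continuous c) : MemLp c 2 (volume.restrict I01) := by
  obtain ⟨B, hB⟩ := isCompact_Icc.exists_bound_of_continuousOn (s := I01) hc.continuousOn
  refine MemLp.of_bound hc.aestronglyMeasurable B ?_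
  filter_upwards [ae_restrict_mem measurableSet_Icc] with x hx using hB x hx

lemma mom0_add_smul (q : L2) {g h : ℝ → ℝ} (hg : IntegrableOn g I01) (hh : IntegrableOn h I01)
    (c : ℝ) : mom0 q (fun x => g x + c * h x) = mom0 q g + c * mom0 q h := by
  rw [mom0, mom0, mom0, ← integral_const_mul, ← integral_add
    (integrableOn_continuous_mul (continuous_etaC_right q) hg)
    ((integrableOn_continuous_mul (continuous_etaC_right q) hh).const_mul c)]
  congr 1
  ext x
  ring

lemma mom1_add_smul (q : L2) {g h : ℝ → ℝ} (hg : IntegrableOn g I01) (hh : IntegrableOn h I01)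
    (c : ℝ) : mom1 q (fun x => g x + c * h x) = mom1 q g + c * mom1 q h := by
  have hc : Continuous fun x => etaC q x * phiC q x :=
    (continuous_etaC_right q).mul (continuous_phiC_right q)
  rw [mom1, mom1, mom1, ← integral_const_mul, ← integral_add
    (integrableOn_continuous_mul hc hg) ((integrableOn_continuous_mul hc hh).const_mul c)]
  congr 1
  ext x
  ring

lemma pr_add_smul (q : L2) {g h : ℝ → ℝ} (hg : IntegrableOn g I01) (hh : IntegrableOn h I01)
    (c x : ℝ) : pr q (fun x => g x + c * h x) x = pr q g x + c * pr q h x := by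
  rw [pr, pr, pr, mom0_add_smul q hg hh, mom1_add_smul q hg hh]
  ring

lemma memLp_pr (q : L2) {g : ℝ → ℝ} (hg : MemLp g 2 (volume.restrict I01)) :
    MemLp (pr q g) 2 (volume.restrict I01) :=
  hg.sub (memLp_of_continuous (continuous_const.add
    (continuous_const.mul (continuous_phiC_right q))))

lemma integrableOn_of_memLp {g : ℝ → ℝ} (hg : MemLp g 2 (volume.restrict I01)) :
    IntegrableOn g I01 := hg.integrable one_le_two

lemma integrableOn_etaC_mul_mul (q : L2) {g h : ℝ → ℝ} (hg : MemLp g 2 (volume.restrict I01))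
    (hh : MemLp h 2 (volume.restrict I01)) : IntegrableOn (fun x => etaC q x * (g x * h x)) I01 :=
  integrableOn_continuous_mul (continuous_etaC_right q) (hg.integrable_mul hh)

lemma mom0_pr {q : L2} (hq : q ∈ Q) {g : ℝ → ℝ} (hg : IntegrableOn g I01) :
    mom0 q (pr q g) = 0 := by
  have i : ∀ n, IntegrableOn (fun x => etaC q x * phiC q x ^ n) I01 := fun n =>
    ((continuous_etaC_right q).mul ((continuous_phiC_right q).pow n)).continuousOn
      |>.integrableOn_compact isCompact_Icc
  have e := integral_combination (integrableOn_continuous_mul (continuous_etaC_right q) hg)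
    (i 0) (i 1) 1 (-(4 * mom0 q g - 6 * mom1 q g)) (-(12 * mom1 q g - 6 * mom0 q g))
  rw [integral_etaC_mul_phiC_pow hq, integral_etaC_mul_phiC_pow hq, ← mom0] at e
  refine Eq.trans ?_ (e.trans ?_)
  · rw [mom0]
    congr 1
    ext x
    simp only [pr]
    ring
  · push_cast
    ring

lemma mom1_pr {q : L2} (hq : q ∈ Q) {g : ℝ → ℝ} (hg : IntegrableOn g I01) :
    mom1 q (pr q g) = 0 := by
  have hc : Continuous fun x => etaC q x * phiC q x :=
    (continuous_etaC_right q).mul (continuous_phiC_right q)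
  have i : ∀ n, IntegrableOn (fun x => etaC q x * phiC q x ^ n) I01 := fun n =>
    ((continuous_etaC_right q).mul ((continuous_phiC_right q).pow n)).continuousOn
      |>.integrableOn_compact isCompact_Icc
  have e := integral_combination (integrableOn_continuous_mul hc hg)
    (i 1) (i 2) 1 (-(4 * mom0 q g - 6 * mom1 q g)) (-(12 * mom1 q g - 6 * mom0 q g))
  rw [integral_etaC_mul_phiC_pow hq, integral_etaC_mul_phiC_pow hq, ← mom1] at e
  refine Eq.trans ?_ (e.trans ?_)
  · rw [mom1]
    congr 1
    ext x
    simp only [pr]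
    ring
  · push_cast
    ring

/-- The projection is self-adjoint. -/
lemma integral_pr_mul_pr {q : L2} (hq : q ∈ Q) {g h : ℝ → ℝ}
    (hg : MemLp g 2 (volume.restrict I01)) (hh : MemLp h 2 (volume.restrict I01)) :
    ∫ x in I01, etaC q x * (pr q g x * pr q h x) = ∫ x in I01, etaC q x * (pr q g x * h x) := by
  have ip := integrableOn_of_memLp (memLp_pr q hg)
  have hc : Continuous fun x => etaC q x * phiC q x :=
    (continuous_etaC_right q).mul (continuous_phiC_right q)
  have e := integral_combination (integrableOn_etaC_mul_mul q (memLp_pr q hg) hh)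
    (integrableOn_continuous_mul (continuous_etaC_right q) ip)
    (integrableOn_continuous_mul hc ip) 1 (-(4 * mom0 q h - 6 * mom1 q h))
    (-(12 * mom1 q h - 6 * mom0 q h))
  have e0 := mom0_pr hq (integrableOn_of_memLp hg)
  have e1 := mom1_pr hq (integrableOn_of_memLp hg)
  rw [mom0] at e0
  rw [mom1] at e1
  rw [e0, e1, one_mul, mul_zero, mul_zero, add_zero, add_zero] at e
  rw [← e]
  congr 1
  ext x
  simp only [pr]
  ring

/-- The squared dual norm of the projection of `g` onto the cotangent space. -/
def nrg (q : L2) (g : ℝ → ℝ) : ℝ := ∫ x in I01, etaC q x * (pr q g x * pr q g x)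

lemma nrg_congr (q : L2) {g h : ℝ → ℝ} (e : g =ᵐ[volume.restrict I01] h) :
    nrg q g = nrg q h :=
  integral_congr_ae (by filter_upwards [pr_congr q e] with x hx; rw [hx])

lemma nrg_nonneg (q : L2) (g : ℝ → ℝ) : 0 ≤ nrg q g :=
  integral_nonneg fun x => mul_nonneg (etaC_pos q x).le (mul_self_nonneg _)

lemma nrg_add_smul {q : L2} (hq : q ∈ Q) {g h : ℝ → ℝ}
    (hg : MemLp g 2 (volume.restrict I01)) (hh : MemLp h 2 (volume.restrict I01)) (c : ℝ) :
    nrg q (fun x => g x + c * h x) = nrg q g +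
      2 * c * (∫ x in I01, etaC q x * (pr q g x * h x)) + c ^ 2 * nrg q h := by
  have pg := memLp_pr q hg
  have ph := memLp_pr q hh
  have e := integral_combination (integrableOn_etaC_mul_mul q pg pg)
    (integrableOn_etaC_mul_mul q pg ph) (integrableOn_etaC_mul_mul q ph ph) 1 (2 * c) (c ^ 2)
  rw [← nrg, ← nrg, one_mul] at e
  rw [← integral_pr_mul_pr hq hg hh, ← e, nrg]
  congr 1
  ext x
  rw [pr_add_smul q (integrableOn_of_memLp hg) (integrableOn_of_memLp hh)]
  ring

lemma nrg_le {q : L2} (hq : q ∈ Q) {g : ℝ → ℝ} (hg : MemLp g 2 (volume.restrict I01)) :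
    nrg q g ≤ ∫ x in I01, etaC q x * (g x * g x) := by
  have pg := memLp_pr q hg
  have h0 : 0 ≤ ∫ x in I01, etaC q x * ((g x - pr q g x) * (g x - pr q g x)) :=
    integral_nonneg fun x => mul_nonneg (etaC_pos q x).le (mul_self_nonneg _)
  have e := integral_combination (integrableOn_etaC_mul_mul q hg hg)
    (integrableOn_etaC_mul_mul q pg hg) (integrableOn_etaC_mul_mul q pg pg) 1 (-2) 1
  have e' : ∫ x in I01, etaC q x * ((g x - pr q g x) * (g x - pr q g x)) = ∫ x in I01,
      (1 * (etaC q x * (g x * g x)) + -2 * (etaC q x * (pr q g x * g x)) +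
        1 * (etaC q x * (pr q g x * pr q g x))) := by
    congr 1
    ext x
    ring
  rw [e', e] at h0
  rw [← integral_pr_mul_pr hq hg hg, ← nrg] at h0
  linarith

lemma conormSq_eq {q : L2} {f g : ℝ → ℝ} (hg : MemLp g 2 (volume.restrict I01))
    (hf : ∀ x ∈ I01, f x = pr q g x) : conormSq q f = ENNReal.ofReal (nrg q g) := by
  rw [conormSq, nrg, ofReal_integral_eq_lintegral_ofReal
    (integrableOn_etaC_mul_mul q (memLp_pr q hg) (memLp_pr q hg))
    (ae_of_all _ fun x => mul_nonneg (etaC_pos q x).le (mul_self_nonneg _))]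
  refine setLIntegral_congr_fun measurableSet_Icc fun x hx => ?_
  simp only [hf x hx, eta_eq q hx, sq]

lemma abs_intervalIntegral_etaC_pr_le {q : L2} (hq : q ∈ Q) {g : ℝ → ℝ}
    (hg : MemLp g 2 (volume.restrict I01)) {x : ℝ} (hx : x ∈ I01) :
    |∫ y in (0 : ℝ)..x, etaC q y * pr q g y| ≤ 1 + nrg q g := by
  have pg := memLp_pr q hg
  have i1 := integrableOn_continuous_mul (continuous_etaC_right q) (integrableOn_of_memLp pg)
  refine (abs_intervalIntegral_le i1 hx).trans ?_
  have i2 : IntegrableOn (etaC q) I01 :=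
    (continuous_etaC_right q).continuousOn.integrableOn_compact isCompact_Icc
  rw [nrg, ← integral_etaC hq, ← integral_add i2 (integrableOn_etaC_mul_mul q pg pg)]
  refine integral_mono i1.abs (i2.add (integrableOn_etaC_mul_mul q pg pg)) fun y => ?_
  have h := etaC_pos q y
  rw [abs_mul, abs_of_pos h, ← mul_one_add]
  refine mul_le_mul_of_nonneg_left ?_ h.le
  nlinarith [abs_mul_abs_self (pr q g y), sq_nonneg (|pr q g y| - 1), abs_nonneg (pr q g y)]

/-- Pairing with the operator `U` amounts to integrating a primitive against the measure. -/
lemma integral_mul_UMeas (q : L2) {k : ℝ → ℝ} (hk : IntegrableOn k I01) (m : Measure ℝ)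
    [IsFiniteMeasure m] (hm : m I01ᶜ = 0) :
    2 * ∫ x in I01, k x * UMeas q m x = ∫ y, etaC q y * (∫ u in (0 : ℝ)..y, k u) ∂m := by
  set S : Set (ℝ × ℝ) := {z | z.1 ≤ z.2} with hS
  have hSm : MeasurableSet S := measurableSet_le measurable_fst measurable_snd
  have hmem : ∀ᵐ y ∂m, y ∈ I01 := mem_ae_iff.2 hm
  set F : ℝ → ℝ → ℝ := fun x y => k x * S.indicator (fun z => etaC q z.2) (x, y) with hF
  have hFi : Integrable (Function.uncurry F) (((volume : Measure ℝ).restrict I01).prod m) := by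
    refine (Integrable.mul_prod hk.norm (integrable_const (Real.exp ‖q‖))).mono' ?_ ?_
    · refine hk.aestronglyMeasurable.comp_fst.mul ?_
      exact (((continuous_etaC_right q).measurable.comp measurable_snd).indicator
        hSm).aestronglyMeasurable
    · refine ae_of_all _ fun z => ?_
      simp only [Function.uncurry, hF, norm_mul]
      refine mul_le_mul_of_nonneg_left ?_ (norm_nonneg _)
      by_cases hz : z ∈ S
      · rw [indicator_of_mem (by simpa using hz), Real.norm_eq_abs, abs_of_pos (etaC_pos _ _)]
        exact etaC_le _ _
      · rw [indicator_of_notMem (by simpa using hz), norm_zero]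
        positivity
  have hl : 2 * ∫ x in I01, k x * UMeas q m x = ∫ x in I01, ∫ y, F x y ∂m := by
    rw [← integral_const_mul]
    refine setIntegral_congr_fun measurableSet_Icc fun x hx => ?_
    simp only [hF]
    rw [integral_const_mul, UMeas, ← integral_indicator measurableSet_Icc]
    have : ∫ y, (Icc x 1).indicator (fun y => eta q y) y ∂m =
        ∫ y, S.indicator (fun z => etaC q z.2) (x, y) ∂m := by
      refine integral_congr_ae ?_
      filter_upwards [hmem] with y hy
      by_cases hxy : x ≤ y
      · rw [indicator_of_mem (show y ∈ Icc x 1 from ⟨hxy, hy.2⟩), indicator_of_mem (by exact hxy),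
          eta_eq q hy]
      · rw [indicator_of_notMem (fun h => hxy h.1), indicator_of_notMem (by exact hxy)]
    rw [this]
    ring
  rw [hl, integral_integral_swap hFi]
  refine integral_congr_ae ?_
  filter_upwards [hmem] with y hy
  rw [intervalIntegral_eq_setIntegral hy, ← integral_const_mul]
  congr 1
  ext x
  by_cases hxy : x ≤ y
  · simp only [hF]
    rw [indicator_of_mem (by exact hxy), indicator_of_mem (by exact hxy)]
    ring
  · simp only [hF]
    rw [indicator_of_notMem (by exact hxy), indicator_of_notMem (by exact hxy)]
    ring

lemma abs_UMeas_le (q : L2) (m : Measure ℝ) [IsFiniteMeasure m] {x : ℝ} (hx : x ∈ I01) :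
    |UMeas q m x| ≤ Real.exp ‖q‖ * m.real univ := by
  have h : |∫ y in Icc x 1, eta q y ∂m| ≤ Real.exp ‖q‖ * m.real (Icc x 1) := by
    refine norm_setIntegral_le_of_norm_le_const (f := fun y => eta q y) (measure_lt_top m _)
      fun y hy => ?_
    rw [eta_eq q ⟨hx.1.trans hy.1, hy.2⟩, Real.norm_eq_abs, abs_of_pos (etaC_pos _ _)]
    exact etaC_le _ _
  have h2 : Real.exp ‖q‖ * m.real (Icc x 1) ≤ Real.exp ‖q‖ * m.real univ := by
    exact mul_le_mul_of_nonneg_left (measureReal_mono (subset_univ _)) (Real.exp_pos _).le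
  rw [UMeas, abs_mul]
  norm_num
  have := abs_nonneg (∫ y in Icc x 1, eta q y ∂m)
  linarith

/-! ### Disintegrations in time -/

lemma isDisintegration_slice {μ : Measure (ℝ × ℝ)} (hμ : μ ∈ measD0) :
    IsDisintegration μ (slice μ) := by
  obtain ⟨_, κ, hκ, _⟩ := hμ
  have h : ∃ κ : Kernel ℝ ℝ, IsDisintegration μ κ := ⟨κ, hκ⟩
  rw [slice, dif_pos h]
  exact h.choose_spec

lemma slice_prod {μ : Measure (ℝ × ℝ)} (hμ : μ ∈ measD0) {A B : Set ℝ} (hA : MeasurableSet A)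
    (hB : MeasurableSet B) : μ (A ×ˢ B) = ∫⁻ t in A, slice μ t B ∂(volume.restrict I01) := by
  obtain ⟨h1, h2⟩ := isDisintegration_slice hμ
  nth_rw 1 [h2]
  exact Measure.compProd_apply_prod hA hB

/-- The measures in `M₀(D)` whose time derivative is a measure have slices of bounded mass. -/
lemma exists_slice_bound {μ : Measure (ℝ × ℝ)} (hμ : μ ∈ measD0) {δ : SignedMeasure (ℝ × ℝ)}
    (hδ : IsTimeDeriv μ δ) : ∃ K : ℝ, ∀ᵐ t ∂(volume.restrict I01),
      IsFiniteMeasure (slice μ t) ∧ (slice μ t).real univ ≤ K ∧ slice μ t I01ᶜ = 0 := by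
  obtain ⟨K, hK⟩ := hδ.exists_map_fst_le hμ.1
  refine ⟨K, ?_⟩
  have h1 : ∀ᵐ t ∂(volume.restrict I01), slice μ t univ ≤ K := by
    refine ae_le_of_forall_setLIntegral_le_of_sigmaFinite
      ((slice μ).measurable_coe MeasurableSet.univ) fun A hA _ => ?_
    rw [← slice_prod hμ hA MeasurableSet.univ, lintegral_const, prod_univ,
      ← Measure.map_apply measurable_fst hA, Measure.restrict_apply_univ]
    refine (hK A).trans (le_of_eq ?_)
    rw [Measure.smul_apply, ENNReal.smul_def, smul_eq_mul]
  have h2 : ∀ᵐ t ∂(volume.restrict I01), slice μ t I01ᶜ = 0 := by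
    have h : ∫⁻ t in univ, slice μ t I01ᶜ ∂(volume.restrict I01) = 0 := by
      rw [← slice_prod hμ MeasurableSet.univ measurableSet_Icc.compl]
      refine measure_mono_null ?_ hμ.1.2
      rintro z ⟨_, hz⟩ hzD
      exact hz hzD.2
    rw [Measure.restrict_univ] at h
    exact (lintegral_eq_zero_iff ((slice μ).measurable_coe measurableSet_Icc.compl)).1 h
  filter_upwards [h1, h2] with t ht1 ht2
  have hf : IsFiniteMeasure (slice μ t) := ⟨ht1.trans_lt ENNReal.coe_lt_top⟩
  refine ⟨hf, ?_, ht2⟩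
  exact ENNReal.toReal_le_coe_of_le_coe ht1

/-- Disintegrations of finite measures are determined for almost every time, hence they depend
linearly on the measure. -/
lemma slice_combination {μ₁ μ₂ ν : Measure (ℝ × ℝ)} (h₁ : μ₁ ∈ measD0) (h₂ : μ₂ ∈ measD0)
    (hν : ν ∈ measD0) (a b : NNReal) (h : ν = a • μ₁ + b • μ₂) :
    ∀ᵐ t ∂(volume.restrict I01), slice ν t = a • slice μ₁ t + b • slice μ₂ t := by
  have := hν.1.1
  have hB : ∀ B : Set ℝ, MeasurableSet B → ∀ᵐ t ∂(volume.restrict I01),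
      slice ν t B = a * slice μ₁ t B + b * slice μ₂ t B := by
    intro B hB
    have m := (slice ν).measurable_coe hB
    have m₁ := (slice μ₁).measurable_coe hB
    have m₂ := (slice μ₂).measurable_coe hB
    refine ae_eq_of_forall_setLIntegral_eq_of_sigmaFinite m
      ((m₁.const_mul _).add (m₂.const_mul _)) fun A hA _ => ?_
    rw [lintegral_add_left (m₁.const_mul _), lintegral_const_mul _ m₁, lintegral_const_mul _ m₂,
      ← slice_prod h₁ hA hB, ← slice_prod h₂ hA hB, ← slice_prod hν hA hB, h]
    rfl
  have hfin : ∀ᵐ t ∂(volume.restrict I01), slice ν t univ < ⊤ := by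
    refine ae_lt_top ((slice ν).measurable_coe MeasurableSet.univ) ?_
    have e := slice_prod hν (A := univ) (B := univ) MeasurableSet.univ MeasurableSet.univ
    rw [Measure.restrict_univ] at e
    rw [← e]
    exact measure_ne_top _ _
  have hQ : ∀ᵐ t ∂(volume.restrict I01), ∀ c : ℚ,
      slice ν t (Iic (c : ℝ)) = a * slice μ₁ t (Iic (c : ℝ)) + b * slice μ₂ t (Iic (c : ℝ)) :=
    ae_all_iff.2 fun c => hB _ measurableSet_Iic
  filter_upwards [hfin, hQ, hB univ MeasurableSet.univ] with t ht1 ht2 ht3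
  have : IsFiniteMeasure (slice ν t) := ⟨ht1⟩
  refine ext_of_generate_finite _ Real.borel_eq_generateFrom_Iic_rat Real.isPiSystem_Iic_rat ?_ ?_
  · intro s hs
    obtain ⟨c, hc⟩ := mem_iUnion.1 hs
    rw [mem_singleton_iff.1 hc, ht2 c]
    rfl
  · rw [ht3]
    rfl

lemma UMeas_combination (q : L2) {m₁ m₂ : Measure ℝ} [IsFiniteMeasure m₁] [IsFiniteMeasure m₂]
    (a b : NNReal) {x : ℝ} (hx : x ∈ I01) :
    UMeas q (a • m₁ + b • m₂) x = a * UMeas q m₁ x + b * UMeas q m₂ x := by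
  have e : ∀ m : Measure ℝ, UMeas q m x = 1 / 2 * ∫ y in Icc x 1, etaC q y ∂m := fun m => by
    rw [UMeas]
    congr 1
    exact setIntegral_congr_fun measurableSet_Icc fun y hy => eta_eq q ⟨hx.1.trans hy.1, hy.2⟩
  have i : ∀ m : Measure ℝ, IsFiniteMeasure m → IntegrableOn (etaC q) (Icc x 1) m := fun m _ =>
    (continuous_etaC_right q).continuousOn.integrableOn_compact isCompact_Icc
  rw [e, e, e, Measure.restrict_add, Measure.restrict_smul, Measure.restrict_smul,
    integral_add_measure ((i m₁ inferInstance).smul_measure_nnreal)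
      ((i m₂ inferInstance).smul_measure_nnreal),
    integral_smul_nnreal_measure, integral_smul_nnreal_measure]
  simp only [NNReal.smul_def, smul_eq_mul]
  ring

/-! ### Joint measurability in time and space -/

/-- The family `g` of functions of `x ∈ [0,1]`, indexed by `t ∈ [0,1]`, agrees at every time and
almost every point with a function that is jointly measurable. Families of elements of `L²` are
families of equivalence classes, so no more can be asked. -/
def JointlyMeasurable (g : ℝ → ℝ → ℝ) : Prop :=
  ∃ G : ℝ × ℝ → ℝ, Measurable G ∧ ∀ t ∈ I01, ∀ᵐ x ∂(volume.restrict I01), g t x = G (t, x)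

lemma JointlyMeasurable.add {g h : ℝ → ℝ → ℝ} (hg : JointlyMeasurable g)
    (hh : JointlyMeasurable h) : JointlyMeasurable fun t x => g t x + h t x := by
  obtain ⟨G, hG, eG⟩ := hg
  obtain ⟨H, hH, eH⟩ := hh
  refine ⟨fun z => G z + H z, hG.add hH, fun t ht => ?_⟩
  filter_upwards [eG t ht, eH t ht] with x h1 h2
  rw [h1, h2]

lemma JointlyMeasurable.sub {g h : ℝ → ℝ → ℝ} (hg : JointlyMeasurable g)
    (hh : JointlyMeasurable h) : JointlyMeasurable fun t x => g t x - h t x := by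
  obtain ⟨G, hG, eG⟩ := hg
  obtain ⟨H, hH, eH⟩ := hh
  refine ⟨fun z => G z - H z, hG.sub hH, fun t ht => ?_⟩
  filter_upwards [eG t ht, eH t ht] with x h1 h2
  rw [h1, h2]

lemma JointlyMeasurable.mul {g h : ℝ → ℝ → ℝ} (hg : JointlyMeasurable g)
    (hh : JointlyMeasurable h) : JointlyMeasurable fun t x => g t x * h t x := by
  obtain ⟨G, hG, eG⟩ := hg
  obtain ⟨H, hH, eH⟩ := hh
  refine ⟨fun z => G z * H z, hG.mul hH, fun t ht => ?_⟩
  filter_upwards [eG t ht, eH t ht] with x h1 h2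
  rw [h1, h2]

lemma JointlyMeasurable.aestronglyMeasurable {g : ℝ → ℝ → ℝ} (hg : JointlyMeasurable g) {t : ℝ}
    (ht : t ∈ I01) : AEStronglyMeasurable (g t) (volume.restrict I01) := by
  obtain ⟨G, hG, eG⟩ := hg
  exact ⟨fun x => G (t, x), (hG.comp measurable_prodMk_left).stronglyMeasurable, eG t ht⟩

lemma JointlyMeasurable.exists_integral {g : ℝ → ℝ → ℝ} (hg : JointlyMeasurable g) :
    ∃ f : ℝ → ℝ, Measurable f ∧ ∀ t ∈ I01, ∫ x in I01, g t x = f t := by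
  obtain ⟨G, hG, eG⟩ := hg
  refine ⟨fun t => ∫ x in I01, G (t, x), ?_, fun t ht => integral_congr_ae (eG t ht)⟩
  exact (StronglyMeasurable.integral_prod_right' (ν := volume.restrict I01)
    hG.stronglyMeasurable).measurable

lemma JointlyMeasurable.aestronglyMeasurable_integral {g : ℝ → ℝ → ℝ}
    (hg : JointlyMeasurable g) :
    AEStronglyMeasurable (fun t => ∫ x in I01, g t x) (volume.restrict I01) := by
  obtain ⟨f, hf, ef⟩ := hg.exists_integral
  refine ⟨f, hf.stronglyMeasurable, ?_⟩
  filter_upwards [ae_restrict_mem measurableSet_Icc] with t ht using ef t ht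

lemma JointlyMeasurable.integral {g : ℝ → ℝ → ℝ} (hg : JointlyMeasurable g) :
    JointlyMeasurable fun t _ => ∫ x in I01, g t x := by
  obtain ⟨f, hf, ef⟩ := hg.exists_integral
  exact ⟨fun z => f z.1, hf.comp measurable_fst, fun t ht => ae_of_all _ fun _ => ef t ht⟩

lemma JointlyMeasurable.const (c : ℝ) : JointlyMeasurable fun _ _ => c :=
  ⟨fun _ => c, measurable_const, fun _ _ => ae_of_all _ fun _ => rfl⟩

/-- Primitives in space are jointly measurable with all their values. -/
lemma JointlyMeasurable.exists_primitive {g : ℝ → ℝ → ℝ} (hg : JointlyMeasurable g) :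
    ∃ W : ℝ × ℝ → ℝ, Measurable W ∧
      ∀ t ∈ I01, ∀ x ∈ I01, ∫ y in (0 : ℝ)..x, g t y = W (t, x) := by
  obtain ⟨G, hG, eG⟩ := hg
  refine ⟨fun z => ∫ y in I01, (Iic z.2).indicator (fun y => G (z.1, y)) y, ?_,
    fun t ht x hx => ?_⟩
  · have hm : Measurable fun u : (ℝ × ℝ) × ℝ =>
        {u : (ℝ × ℝ) × ℝ | u.2 ≤ u.1.2}.indicator (fun u => G (u.1.1, u.2)) u :=
      (hG.comp ((measurable_fst.comp measurable_fst).prodMk measurable_snd)).indicator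
        (measurableSet_le measurable_snd (measurable_snd.comp measurable_fst))
    exact (StronglyMeasurable.integral_prod_right' (ν := volume.restrict I01)
      hm.stronglyMeasurable).measurable
  · rw [intervalIntegral_eq_setIntegral hx]
    refine integral_congr_ae ?_
    filter_upwards [eG t ht] with y hy
    by_cases hyx : y ∈ Iic x
    · rw [indicator_of_mem hyx, indicator_of_mem hyx, hy]
    · rw [indicator_of_notMem hyx, indicator_of_notMem hyx]

lemma measurable_continuousOn_comp_clamp {q : ℝ → L2} (hq : ContinuousOn q I01) :
    Measurable fun t => q (clamp t) :=
  (hq.comp_continuous continuous_clamp clamp_mem).measurable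

lemma measurable_uncurry_comp_clamp {q : ℝ → L2} (hq : ContinuousOn q I01) {Φ : L2 → ℝ → ℝ}
    (hΦ : Measurable (Function.uncurry Φ)) :
    Measurable fun z : ℝ × ℝ => Φ (q (clamp z.1)) z.2 :=
  hΦ.comp (((measurable_continuousOn_comp_clamp hq).comp measurable_fst).prodMk measurable_snd)

lemma jointlyMeasurable_comp {q : ℝ → L2} (hq : ContinuousOn q I01) {Φ : L2 → ℝ → ℝ}
    (hΦ : Measurable (Function.uncurry Φ)) : JointlyMeasurable fun t x => Φ (q t) x := by
  refine ⟨_, measurable_uncurry_comp_clamp hq hΦ, fun t ht => ae_of_all _ fun x => ?_⟩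
  simp only [clamp_of_mem ht]

lemma jointlyMeasurable_etaC {q : ℝ → L2} (hq : ContinuousOn q I01) :
    JointlyMeasurable fun t x => etaC (q t) x :=
  jointlyMeasurable_comp hq continuous_etaC.measurable

lemma jointlyMeasurable_phiC {q : ℝ → L2} (hq : ContinuousOn q I01) :
    JointlyMeasurable fun t x => phiC (q t) x :=
  jointlyMeasurable_comp hq continuous_phiC.measurable

lemma jointlyMeasurable_coe {p : ℝ → L2} (hp : ContinuousOn p I01) :
    JointlyMeasurable fun t x => p t x := by
  obtain ⟨G, hG, eG⟩ := jointlyMeasurable_comp hp (Φ := fun q x => ev (q, x)) measurable_ev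
  refine ⟨G, hG, fun t ht => ?_⟩
  filter_upwards [eG t ht, ev_ae_eq (p t)] with x h1 h2
  rw [← h1, h2]

lemma jointlyMeasurable_deriv (p : ℝ → L2) : JointlyMeasurable fun t x => (deriv p t : L2) x := by
  refine ⟨fun z => ev (deriv p z.1, z.2), ?_, fun t _ => ?_⟩
  · exact measurable_ev.comp (((stronglyMeasurable_deriv p).measurable.comp measurable_fst).prodMk
      measurable_snd)
  · filter_upwards [ev_ae_eq (deriv p t)] with x h2
    rw [h2]

lemma JointlyMeasurable.pr {q : ℝ → L2} (hq : ContinuousOn q I01) {g : ℝ → ℝ → ℝ}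
    (hg : JointlyMeasurable g) : JointlyMeasurable fun t => pr (q t) (g t) := by
  have he := jointlyMeasurable_etaC hq
  have hφ := jointlyMeasurable_phiC hq
  have h0 : JointlyMeasurable fun t _ => mom0 (q t) (g t) := (he.mul hg).integral
  have h1 : JointlyMeasurable fun t _ => mom1 (q t) (g t) := ((he.mul hφ).mul hg).integral
  exact hg.sub ((((JointlyMeasurable.const 4).mul h0).sub ((JointlyMeasurable.const 6).mul h1)).add
    ((((JointlyMeasurable.const 12).mul h1).sub ((JointlyMeasurable.const 6).mul h0)).mul hφ))

lemma JointlyMeasurable.aestronglyMeasurable_nrg {q : ℝ → L2} (hq : ContinuousOn q I01)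
    {g : ℝ → ℝ → ℝ} (hg : JointlyMeasurable g) :
    AEStronglyMeasurable (fun t => nrg (q t) (g t)) (volume.restrict I01) :=
  ((jointlyMeasurable_etaC hq).mul ((hg.pr hq).mul (hg.pr hq))).aestronglyMeasurable_integral

lemma jointlyMeasurable_UMeas {q : ℝ → L2} (hq : ContinuousOn q I01) (κ : Kernel ℝ ℝ)
    [IsSFiniteKernel κ] : JointlyMeasurable fun t x => UMeas (q t) (κ t) x := by
  obtain ⟨E, hE, eE⟩ : ∃ E : ℝ × ℝ → ℝ, Measurable E ∧ ∀ t ∈ I01, ∀ y, E (t, y) = etaC (q t) y := by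
    exact ⟨_, measurable_uncurry_comp_clamp hq continuous_etaC.measurable,
      fun t ht y => by simp only [clamp_of_mem ht]⟩
  obtain ⟨A, hA⟩ : ∃ A : (ℝ × ℝ) × ℝ → ℝ, A = {u : (ℝ × ℝ) × ℝ | u.1.2 ≤ u.2 ∧ u.2 ≤ 1}.indicator
    (fun u => E (u.1.1, u.2)) := ⟨_, rfl⟩
  have hm : Measurable A := by
    rw [hA]
    refine Measurable.indicator ?_ ?_
    · exact hE.comp ((measurable_fst.comp measurable_fst).prodMk measurable_snd)
    · exact (measurableSet_le (measurable_snd.comp measurable_fst) measurable_snd).inter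
        (measurableSet_le measurable_snd measurable_const)
  have hi : StronglyMeasurable fun z : ℝ × ℝ => ∫ y, A (z, y) ∂κ.comap Prod.fst measurable_fst z :=
    StronglyMeasurable.integral_kernel_prod_right' hm.stronglyMeasurable
  refine ⟨_, hi.measurable.const_mul (1 / 2), fun t ht => ?_⟩
  filter_upwards [ae_restrict_mem measurableSet_Icc] with x hx
  rw [UMeas, ← integral_indicator measurableSet_Icc, Kernel.comap_apply]
  congr 2
  ext y
  rw [hA]
  by_cases hy : y ∈ Icc x 1
  · rw [indicator_of_mem hy, indicator_of_mem (show ((t, x), y) ∈ _ from hy),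
      eta_eq _ ⟨hx.1.trans hy.1, hy.2⟩, eE t ht]
  · rw [indicator_of_notMem hy, indicator_of_notMem (show ((t, x), y) ∉ _ from hy)]

lemma U_eq {q : L2} {f : ℝ → ℝ} (hf : IntegrableOn f I01) {x : ℝ} (hx : x ∈ I01) :
    U q f x = 1 / 2 * ((∫ y in I01, etaC q y * f y) - ∫ y in (0 : ℝ)..x, etaC q y * f y) := by
  have hi : IntegrableOn (fun y => etaC q y * f y) I01 :=
    integrableOn_continuous_mul (continuous_etaC_right q) hf
  have h01 : IntervalIntegrable (fun y => etaC q y * f y) volume 0 1 := by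
    rwa [intervalIntegrable_iff_integrableOn_Icc_of_le zero_le_one]
  have h0x : IntervalIntegrable (fun y => etaC q y * f y) volume 0 x := by
    rw [intervalIntegrable_iff_integrableOn_Icc_of_le hx.1]
    exact hi.mono_set (Icc_subset_Icc_right hx.2)
  rw [← intervalIntegral_one_eq, intervalIntegral.integral_interval_sub_left h01 h0x, U]
  congr 1
  refine intervalIntegral.integral_congr fun y hy => ?_
  simp only [eta_eq q (uIcc_subset_Icc hx (by simp) hy)]

/-! ### The quadratic part of the functional -/

/-- The covariant acceleration of `q̇` before projection, as a covector: `ṗ + U(p²,q)`. -/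
def force (p q : ℝ → L2) (t x : ℝ) : ℝ :=
  (deriv p t : L2) x + U (q t) (fun y => p t y ^ 2) x

/-- The covector `ṗ + U(p²,q) + U(Δ,q)`, whose projection is the one in the functional. -/
def covec (p q : ℝ → L2) (Δ : Measure (ℝ × ℝ)) (t x : ℝ) : ℝ :=
  force p q t x + UMeas (q t) (slice Δ t) x

/-- The measures in `M₀(D)` whose time derivative is a measure. -/
def measBV : Set (Measure (ℝ × ℝ)) := {μ | μ ∈ measD0 ∧ ∃ δ, IsTimeDeriv μ δ}

/-- The part of the functional that is quadratic in the measure. -/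
def quad (p q : ℝ → L2) (Δ : Measure (ℝ × ℝ)) : ENNReal :=
  ∫⁻ t in I01, conormSq (q t)
    (fun x => accelFlat p q t x + projStar (q t) (UMeas (q t) (slice Δ t)) x)

variable {p₀ q₀ : L2} {p q : ℝ → L2} {Δ μ ν : Measure (ℝ × ℝ)}

lemma ae_slice (hμ : μ ∈ measBV) : ∀ᵐ t ∂(volume.restrict I01),
    t ∈ I01 ∧ IsFiniteMeasure (slice μ t) ∧ slice μ t I01ᶜ = 0 := by
  obtain ⟨h, δ, hδ⟩ := hμ
  obtain ⟨K, hK⟩ := exists_slice_bound h hδ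
  filter_upwards [hK, ae_restrict_mem measurableSet_Icc] with t ht ht' using ⟨ht', ht.1, ht.2.2⟩

lemma integrableOn_sq (u : L2) : IntegrableOn (fun x => u x ^ 2) I01 := (Lp.memLp u).integrable_sq

lemma jointlyMeasurable_force (hpq : (p, q) ∈ pathSet p₀ q₀) :
    JointlyMeasurable (force p q) := by
  have hp := jointlyMeasurable_coe (continuousOn_p hpq)
  have hk : JointlyMeasurable fun t y => etaC (q t) y * (p t y * p t y) :=
    (jointlyMeasurable_etaC (continuousOn_q hpq)).mul (hp.mul hp)
  obtain ⟨W, hW, eW⟩ := hk.exists_primitive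
  have hWj : JointlyMeasurable fun t x => W (t, x) := ⟨W, hW, fun _ _ => ae_of_all _ fun _ => rfl⟩
  obtain ⟨G, hG, eG⟩ := (jointlyMeasurable_deriv p).add
    ((JointlyMeasurable.const (1 / 2)).mul (hk.integral.sub hWj))
  refine ⟨G, hG, fun t ht => ?_⟩
  filter_upwards [eG t ht, ae_restrict_mem measurableSet_Icc] with x hx hx01
  rw [← hx, force, U_eq (integrableOn_sq (p t)) hx01, ← eW t ht x hx01]
  simp only [sq]

lemma abs_U_sq_le (q u : L2) {x : ℝ} (hx : x ∈ I01) :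
    |U q (fun y => u y ^ 2) x| ≤ Real.exp ‖q‖ * ‖u‖ ^ 2 := by
  have hu := integrableOn_sq u
  have hi : IntegrableOn (fun y => etaC q y * u y ^ 2) I01 :=
    integrableOn_continuous_mul (continuous_etaC_right q) hu
  have hb : ∫ y in I01, |etaC q y * u y ^ 2| ≤ Real.exp ‖q‖ * ‖u‖ ^ 2 := by
    rw [← integral_sq_eq_norm_sq, ← integral_const_mul]
    refine integral_mono hi.abs (hu.const_mul _) fun y => ?_
    simp only [abs_mul, abs_of_pos (etaC_pos q y), abs_of_nonneg (sq_nonneg (u y))]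
    exact mul_le_mul_of_nonneg_right (etaC_le q y) (sq_nonneg _)
  have h1 := (abs_integral_le_integral_abs (f := fun y => etaC q y * u y ^ 2)
    (μ := volume.restrict I01)).trans hb
  have h2 := (abs_intervalIntegral_le hi hx).trans hb
  rw [U_eq hu hx, abs_mul, abs_of_pos (by norm_num : (0 : ℝ) < 1 / 2)]
  have h3 := abs_sub (∫ y in I01, etaC q y * u y ^ 2) (∫ y in (0 : ℝ)..x, etaC q y * u y ^ 2)
  linarith

lemma memLp_UMeas (hpq : (p, q) ∈ pathSet p₀ q₀) (hμ : μ ∈ measD0) {t : ℝ} (ht : t ∈ I01)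
    [IsFiniteMeasure (slice μ t)] :
    MemLp (UMeas (q t) (slice μ t)) 2 (volume.restrict I01) := by
  have := (isDisintegration_slice hμ).1
  refine MemLp.of_bound
    ((jointlyMeasurable_UMeas (continuousOn_q hpq) (slice μ)).aestronglyMeasurable ht)
    (Real.exp ‖q t‖ * (slice μ t).real univ) ?_
  filter_upwards [ae_restrict_mem measurableSet_Icc] with x hx using abs_UMeas_le _ _ hx

lemma memLp_force (hpq : (p, q) ∈ pathSet p₀ q₀) {t : ℝ} (ht : t ∈ I01) :
    MemLp (force p q t) 2 (volume.restrict I01) := by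
  have hd : MemLp (deriv p t : L2) 2 (volume.restrict I01) := Lp.memLp _
  have hm := ((jointlyMeasurable_force hpq).aestronglyMeasurable ht).sub hd.aestronglyMeasurable
  have hU : MemLp (force p q t - ((deriv p t : L2) : ℝ → ℝ)) 2 (volume.restrict I01) := by
    refine MemLp.of_bound hm (Real.exp ‖q t‖ * ‖p t‖ ^ 2) ?_
    filter_upwards [ae_restrict_mem measurableSet_Icc] with x hx
    rw [Pi.sub_apply, force, add_sub_cancel_left]
    exact abs_U_sq_le _ _ hx
  have := hd.add hU
  rwa [add_sub_cancel] at this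

lemma memLp_covec (hpq : (p, q) ∈ pathSet p₀ q₀) (hμ : μ ∈ measD0) {t : ℝ} (ht : t ∈ I01)
    [IsFiniteMeasure (slice μ t)] : MemLp (covec p q μ t) 2 (volume.restrict I01) :=
  (memLp_force hpq ht).add (memLp_UMeas hpq hμ ht)

lemma pr_covec (hpq : (p, q) ∈ pathSet p₀ q₀) (hμ : μ ∈ measD0) {t : ℝ} (ht : t ∈ I01)
    [IsFiniteMeasure (slice μ t)] (x : ℝ) :
    pr (q t) (covec p q μ t) x =
      pr (q t) (force p q t) x + pr (q t) (UMeas (q t) (slice μ t)) x := by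
  have h := pr_add_smul (q t) (integrableOn_of_memLp (memLp_force hpq ht))
    (integrableOn_of_memLp (memLp_UMeas hpq hμ ht)) 1 x
  simp only [one_mul] at h
  exact h

lemma accel_eq (p q : ℝ → L2) (t x : ℝ) :
    accel p q t x = eta (q t) x * projStar (q t) (force p q t) x :=
  proj_eta_mul (q t) (force p q t) x

/-- Only almost every slice is finite; at the other times `projStar` need not be additive. -/
lemma w_eq (hpq : (p, q) ∈ pathSet p₀ q₀) (hΔ : Δ ∈ measD0) {t : ℝ} (ht : t ∈ I01)
    [IsFiniteMeasure (slice Δ t)] {x : ℝ} (hx : x ∈ I01) :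
    w p q Δ (t, x) =
      etaC (q t) x * ∫ y in (0 : ℝ)..x, etaC (q t) y * pr (q t) (covec p q Δ t) y := by
  rw [w, eta_eq _ hx]
  congr 1
  refine intervalIntegral.integral_congr fun y hy => ?_
  have hy01 : y ∈ I01 := uIcc_subset_Icc (by simp) hx hy
  simp only [accel_eq, pr_covec hpq hΔ ht, projStar_eq _ _ hy01, eta_eq _ hy01]
  ring

lemma conormSq_covec (hpq : (p, q) ∈ pathSet p₀ q₀) (hμ : μ ∈ measD0) {t : ℝ} (ht : t ∈ I01)
    [IsFiniteMeasure (slice μ t)] :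
    conormSq (q t) (fun x => accelFlat p q t x + projStar (q t) (UMeas (q t) (slice μ t)) x) =
      ENNReal.ofReal (nrg (q t) (covec p q μ t)) := by
  refine conormSq_eq (memLp_covec hpq hμ ht) fun x hx => ?_
  rw [accelFlat, accel_eq, mul_div_cancel_left₀ _ (show eta (q t) x ≠ 0 from (Real.exp_pos _).ne'),
    projStar_eq _ _ hx,
    projStar_eq _ _ hx, pr_covec hpq hμ ht]

/-- Projecting does not increase the dual norm, so a bound on the covectors before projection
is enough. -/
lemma integrableOn_nrg (hpq : (p, q) ∈ pathSet p₀ q₀) {g : ℝ → ℝ → ℝ} (hg : JointlyMeasurable g)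
    {b : ℝ → ℝ} (hb : IntegrableOn b I01) (h : ∀ᵐ t ∂(volume.restrict I01),
      MemLp (g t) 2 (volume.restrict I01) ∧ ∫ x in I01, g t x ^ 2 ≤ b t) :
    IntegrableOn (fun t => nrg (q t) (g t)) I01 := by
  obtain ⟨M, hM⟩ := exists_norm_le_of_continuousOn (continuousOn_q hpq)
  refine (hb.const_mul (Real.exp M)).mono' (hg.aestronglyMeasurable_nrg (continuousOn_q hpq)) ?_
  filter_upwards [h, ae_restrict_mem measurableSet_Icc] with t ht ht01
  rw [Real.norm_eq_abs, abs_of_nonneg (nrg_nonneg _ _)]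
  refine (nrg_le (hpq.2.1 t ht01).1 ht.1).trans ?_
  have h1 : ∫ x in I01, etaC (q t) x * (g t x * g t x) ≤ Real.exp M * ∫ x in I01, g t x ^ 2 := by
    rw [← integral_const_mul]
    refine integral_mono (integrableOn_etaC_mul_mul _ ht.1 ht.1)
      (ht.1.integrable_sq.const_mul _) fun x => ?_
    simp only [← sq]
    exact mul_le_mul_of_nonneg_right
      ((etaC_le _ _).trans (Real.exp_le_exp.2 (hM t ht01))) (sq_nonneg _)
  exact h1.trans (mul_le_mul_of_nonneg_left ht.2 (Real.exp_pos _).le)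

lemma jointlyMeasurable_slice (hpq : (p, q) ∈ pathSet p₀ q₀) (hμ : μ ∈ measD0) :
    JointlyMeasurable fun t => UMeas (q t) (slice μ t) := by
  have := (isDisintegration_slice hμ).1
  exact jointlyMeasurable_UMeas (continuousOn_q hpq) (slice μ)

lemma exists_abs_UMeas_le (hpq : (p, q) ∈ pathSet p₀ q₀) (hμ : μ ∈ measBV) :
    ∃ C, ∀ᵐ t ∂(volume.restrict I01), ∀ x ∈ I01, |UMeas (q t) (slice μ t) x| ≤ C := by
  obtain ⟨h, δ, hδ⟩ := hμ
  obtain ⟨K, hK⟩ := exists_slice_bound h hδ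
  obtain ⟨M, hM⟩ := exists_norm_le_of_continuousOn (continuousOn_q hpq)
  refine ⟨Real.exp M * K, ?_⟩
  filter_upwards [hK, ae_restrict_mem measurableSet_Icc] with t ht ht01 x hx
  have := ht.1
  exact (abs_UMeas_le _ _ hx).trans (mul_le_mul (Real.exp_le_exp.2 (hM t ht01)) ht.2.1
    measureReal_nonneg (Real.exp_pos _).le)

lemma integrableOn_nrg_UMeas (hpq : (p, q) ∈ pathSet p₀ q₀) (hμ : μ ∈ measBV) :
    IntegrableOn (fun t => nrg (q t) (UMeas (q t) (slice μ t))) I01 := by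
  obtain ⟨C, hC⟩ := exists_abs_UMeas_le hpq hμ
  refine integrableOn_nrg hpq (jointlyMeasurable_slice hpq hμ.1) (b := fun _ => C ^ 2)
    (integrable_const _) ?_
  filter_upwards [hC, ae_slice hμ] with t ht ⟨ht01, hf, _⟩
  have hm := memLp_UMeas hpq hμ.1 ht01
  refine ⟨hm, ?_⟩
  calc ∫ x in I01, UMeas (q t) (slice μ t) x ^ 2 ≤ ∫ x in I01, C ^ 2 := by
        refine setIntegral_mono_on hm.integrable_sq (integrable_const _) measurableSet_Icc
          fun x hx => ?_
        exact sq_le_sq' (abs_le.1 (ht x hx)).1 (abs_le.1 (ht x hx)).2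
    _ = C ^ 2 := by simp

lemma integrableOn_nrg_covec (hpq : (p, q) ∈ pathSet p₀ q₀) (hμ : μ ∈ measBV) :
    IntegrableOn (fun t => nrg (q t) (covec p q μ t)) I01 := by
  obtain ⟨C, hC⟩ := exists_abs_UMeas_le hpq hμ
  obtain ⟨M, hM⟩ := exists_norm_le_of_continuousOn (continuousOn_q hpq)
  obtain ⟨V, hV⟩ := exists_norm_le_of_continuousOn (continuousOn_p hpq)
  obtain ⟨B, hB⟩ : ∃ B, B = Real.exp M * V ^ 2 + C := ⟨_, rfl⟩
  have hb : IntegrableOn (fun t => 2 * ‖deriv p t‖ ^ 2 + 2 * B ^ 2) I01 := by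
    have h := (integrable_norm_deriv_sq hpq).const_mul 2
    exact Integrable.add h (integrable_const (2 * B ^ 2))
  refine integrableOn_nrg hpq
    ((jointlyMeasurable_force hpq).add (jointlyMeasurable_slice hpq hμ.1))
    (b := fun t => 2 * ‖deriv p t‖ ^ 2 + 2 * B ^ 2)
    hb ?_
  filter_upwards [hC, ae_slice hμ] with t ht ⟨ht01, hf, _⟩
  have hm := memLp_covec hpq hμ.1 ht01
  refine ⟨hm, ?_⟩
  have hi := (integrableOn_sq (deriv p t)).const_mul 2
  calc ∫ x in I01, covec p q μ t x ^ 2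
      ≤ ∫ x in I01, (2 * (deriv p t : L2) x ^ 2 + 2 * B ^ 2) := by
        refine setIntegral_mono_on hm.integrable_sq (hi.add (integrable_const _))
          measurableSet_Icc fun x hx => ?_
        have h1 := abs_U_sq_le (q t) (p t) hx
        have h2 : Real.exp ‖q t‖ * ‖p t‖ ^ 2 ≤ Real.exp M * V ^ 2 := by
          have := hM t ht01
          have := hV t ht01
          gcongr
        have h3 : |U (q t) (fun y => p t y ^ 2) x + UMeas (q t) (slice μ t) x| ≤ B :=
          hB ▸ (abs_add_le _ _).trans (add_le_add (h1.trans h2) (ht x hx))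
        have h4 := sq_le_sq' (abs_le.1 h3).1 (abs_le.1 h3).2
        have h5 : covec p q μ t x = (deriv p t : L2) x +
            (U (q t) (fun y => p t y ^ 2) x + UMeas (q t) (slice μ t) x) := by
          rw [covec, force, add_assoc]
        rw [h5]
        nlinarith [sq_nonneg ((deriv p t : L2) x -
          (U (q t) (fun y => p t y ^ 2) x + UMeas (q t) (slice μ t) x))]
    _ = 2 * ‖deriv p t‖ ^ 2 + 2 * B ^ 2 := by
        rw [integral_add hi (integrable_const _), integral_const_mul, integral_sq_eq_norm_sq]
        simp

lemma quad_eq (hpq : (p, q) ∈ pathSet p₀ q₀) (hμ : μ ∈ measBV) :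
    quad p q μ = ENNReal.ofReal (∫ t in I01, nrg (q t) (covec p q μ t)) := by
  rw [ofReal_integral_eq_lintegral_ofReal (integrableOn_nrg_covec hpq hμ)
    (ae_of_all _ fun t => nrg_nonneg _ _), quad]
  refine lintegral_congr_ae ?_
  filter_upwards [ae_slice hμ] with t ⟨ht01, hf, _⟩ using conormSq_covec hpq hμ.1 ht01

/-! ### The pairing with `w` -/

lemma ae_of_ae_time (hμ : μ ∈ measBV) {P : ℝ → Prop} (h : ∀ᵐ t ∂(volume.restrict I01), P t) :
    ∀ᵐ z ∂μ, P z.1 := by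
  obtain ⟨hD, δ, hδ⟩ := hμ
  obtain ⟨K, hK⟩ := hδ.exists_map_fst_le hD.1
  have hac : μ.map Prod.fst ≪ volume.restrict I01 :=
    (Measure.absolutelyContinuous_of_le hK).trans (Measure.AbsolutelyContinuous.rfl.smul_left K)
  exact ae_of_ae_map measurable_fst.aemeasurable (hac.ae_le h)

/-- The function `w` is integrable, because `sup_x |w(t,x)|` is integrable in time and the time
marginal of the measure has a bounded density. -/
lemma integrable_w (hpq : (p, q) ∈ pathSet p₀ q₀) (hΔ : Δ ∈ measBV) (hμ : μ ∈ measBV) :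
    Integrable (w p q Δ) μ := by
  have hq := continuousOn_q hpq
  have := hμ.1.1.1
  obtain ⟨M, hM⟩ := exists_norm_le_of_continuousOn hq
  obtain ⟨δ, hδ⟩ := hμ.2
  obtain ⟨K, hK⟩ := hδ.exists_map_fst_le hμ.1.1
  have hj : JointlyMeasurable fun t y => etaC (q t) y * pr (q t) (covec p q Δ t) y :=
    (jointlyMeasurable_etaC hq).mul
      (((jointlyMeasurable_force hpq).add (jointlyMeasurable_slice hpq hΔ.1)).pr hq)
  obtain ⟨W, hW, eW⟩ := hj.exists_primitive
  have hE := measurable_uncurry_comp_clamp hq continuous_etaC.measurable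
  have hz : ∀ᵐ z ∂μ, z.2 ∈ I01 :=
    Filter.mem_of_superset (mem_ae_iff.2 hμ.1.1.2 : D ∈ ae μ) fun z h => h.2
  have hgood := ae_of_ae_time hμ (ae_slice hΔ)
  have hb : Integrable (fun t => Real.exp M * (1 + nrg (q t) (covec p q Δ t)))
      (μ.map Prod.fst) := by
    refine Integrable.mono_measure ?_ hK
    exact (((integrable_const 1).add (integrableOn_nrg_covec hpq hΔ)).const_mul
      _).smul_measure_nnreal
  refine (hb.comp_measurable measurable_fst).mono' ⟨_, (hE.mul hW).stronglyMeasurable, ?_⟩ ?_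
  · filter_upwards [hz, hgood] with z hz2 ⟨hz1, hf, _⟩
    have h := w_eq hpq hΔ.1 hz1 hz2
    rw [eW _ hz1 _ hz2] at h
    rw [Pi.mul_apply, clamp_of_mem hz1]
    exact h
  · filter_upwards [hz, hgood] with z hz2 ⟨hz1, hf, _⟩
    have h := w_eq hpq hΔ.1 hz1 hz2
    rw [Prod.mk.eta] at h
    rw [h, norm_mul, Real.norm_eq_abs, Real.norm_eq_abs, abs_of_pos (etaC_pos _ _)]
    exact mul_le_mul ((etaC_le _ _).trans (Real.exp_le_exp.2 (hM _ hz1)))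
      (abs_intervalIntegral_etaC_pr_le (hpq.2.1 _ hz1).1 (memLp_covec hpq hΔ.1 hz1) hz2)
      (abs_nonneg _) (Real.exp_pos _).le

/-- The density in time of the pairing of `w` with a measure. -/
def pairing (p q : ℝ → L2) (Δ μ : Measure (ℝ × ℝ)) (t : ℝ) : ℝ :=
  2 * ∫ x in I01, etaC (q t) x * (pr (q t) (covec p q Δ t) x * UMeas (q t) (slice μ t) x)

lemma pairing_ae_eq (hpq : (p, q) ∈ pathSet p₀ q₀) (hΔ : Δ ∈ measBV) (hμ : μ ∈ measBV) :
    ∀ᵐ t ∂(volume.restrict I01), pairing p q Δ μ t = ∫ y, w p q Δ (t, y) ∂slice μ t := by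
  filter_upwards [ae_slice hΔ, ae_slice hμ] with t ⟨ht01, hf, _⟩ ⟨_, hf', hn⟩
  have hk : IntegrableOn (fun x => etaC (q t) x * pr (q t) (covec p q Δ t) x) I01 :=
    integrableOn_continuous_mul (continuous_etaC_right _)
      (integrableOn_of_memLp (memLp_pr _ (memLp_covec hpq hΔ.1 ht01)))
  have h := integral_mul_UMeas (q t) hk (slice μ t) hn
  simp only [mul_assoc] at h
  rw [pairing, h]
  refine integral_congr_ae ?_
  filter_upwards [(mem_ae_iff.2 hn : I01 ∈ ae (slice μ t))] with y hy
  rw [w_eq hpq hΔ.1 ht01 hy]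

lemma integrableOn_pairing (hpq : (p, q) ∈ pathSet p₀ q₀) (hΔ : Δ ∈ measBV) (hμ : μ ∈ measBV) :
    IntegrableOn (pairing p q Δ μ) I01 := by
  obtain ⟨h1, h2⟩ := isDisintegration_slice hμ.1
  have hi := integrable_w hpq hΔ hμ
  rw [h2] at hi
  have h3 : Integrable (fun t => ∫ y, w p q Δ (t, y) ∂slice μ t) (volume.restrict I01) :=
    Integrable.integral_compProd (κ := Kernel.const Unit (volume.restrict I01))
      (η := Kernel.prodMkLeft Unit (slice μ)) (a := ()) hi
  refine h3.congr ?_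
  filter_upwards [pairing_ae_eq hpq hΔ hμ] with t ht using ht.symm

lemma integral_pairing (hpq : (p, q) ∈ pathSet p₀ q₀) (hΔ : Δ ∈ measBV) (hμ : μ ∈ measBV) :
    ∫ t in I01, pairing p q Δ μ t = ∫ z, w p q Δ z ∂μ := by
  obtain ⟨h1, h2⟩ := isDisintegration_slice hμ.1
  have hi := integrable_w hpq hΔ hμ
  nth_rw 2 [h2]
  rw [Measure.integral_compProd (h2 ▸ hi)]
  exact integral_congr_ae (pairing_ae_eq hpq hΔ hμ)

/-! ### First order expansion of the quadratic part -/

/-- The quadratic part lies above its tangent, whose slope is the pairing with `w`. -/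
lemma add_integral_w_sub_le (hpq : (p, q) ∈ pathSet p₀ q₀) (hΔ : Δ ∈ measBV) (hν : ν ∈ measBV) :
    (∫ t in I01, nrg (q t) (covec p q Δ t)) + ((∫ z, w p q Δ z ∂ν) - ∫ z, w p q Δ z ∂Δ) ≤
      ∫ t in I01, nrg (q t) (covec p q ν t) := by
  have i1 := integrableOn_nrg_covec hpq hΔ
  have i2 := integrableOn_pairing hpq hΔ hν
  have i3 := integrableOn_pairing hpq hΔ hΔ
  have e := integral_combination i1 i2 i3 1 1 (-1)
  rw [integral_pairing hpq hΔ hν, integral_pairing hpq hΔ hΔ] at e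
  have e' : (∫ t in I01, nrg (q t) (covec p q Δ t)) +
      ((∫ z, w p q Δ z ∂ν) - ∫ z, w p q Δ z ∂Δ) = _ := Eq.trans (by ring) e.symm
  rw [e']
  refine integral_mono_ae (((i1.const_mul 1).add (i2.const_mul 1)).add (i3.const_mul (-1)))
    (integrableOn_nrg_covec hpq hν) ?_
  filter_upwards [ae_slice hΔ, ae_slice hν] with t ⟨ht, hf, _⟩ ⟨_, hf', _⟩
  have mΔ := memLp_UMeas hpq hΔ.1 ht
  have mν := memLp_UMeas hpq hν.1 ht
  have mp := memLp_pr (q t) (memLp_covec hpq hΔ.1 ht)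
  have e := nrg_add_smul (hpq.2.1 t ht).1 (memLp_covec hpq hΔ.1 ht) (mν.sub mΔ) 1
  have e1 : (fun x => covec p q Δ t x +
      1 * (UMeas (q t) (slice ν t) - UMeas (q t) (slice Δ t)) x) = covec p q ν t := by
    ext x
    simp only [covec, Pi.sub_apply]
    ring
  have e2 : ∫ x in I01, etaC (q t) x * (pr (q t) (covec p q Δ t) x *
      (UMeas (q t) (slice ν t) - UMeas (q t) (slice Δ t)) x) =
      (∫ x in I01, etaC (q t) x * (pr (q t) (covec p q Δ t) x * UMeas (q t) (slice ν t) x)) -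
      ∫ x in I01, etaC (q t) x * (pr (q t) (covec p q Δ t) x * UMeas (q t) (slice Δ t) x) := by
    rw [← integral_sub (integrableOn_etaC_mul_mul _ mp mν) (integrableOn_etaC_mul_mul _ mp mΔ)]
    congr 1
    ext x
    rw [Pi.sub_apply]
    ring
  rw [e1, e2] at e
  have h0 := nrg_nonneg (q t) (UMeas (q t) (slice ν t) - UMeas (q t) (slice Δ t))
  simp only [pairing]
  linarith

/-- The quadratic part along a line. -/
lemma integral_nrg_line (hpq : (p, q) ∈ pathSet p₀ q₀) (hΔ : Δ ∈ measBV)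
    (hμ : μ ∈ measBV) (c : ℝ) (h : ∀ᵐ t ∂(volume.restrict I01), ∀ x ∈ I01,
      UMeas (q t) (slice ν t) x = UMeas (q t) (slice Δ t) x + c * UMeas (q t) (slice μ t) x) :
    ∫ t in I01, nrg (q t) (covec p q ν t) = (∫ t in I01, nrg (q t) (covec p q Δ t)) +
      c * (∫ z, w p q Δ z ∂μ) + c ^ 2 * ∫ t in I01, nrg (q t) (UMeas (q t) (slice μ t)) := by
  rw [← integral_pairing hpq hΔ hμ]
  have e := integral_combination (integrableOn_nrg_covec hpq hΔ) (integrableOn_pairing hpq hΔ hμ)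
    (integrableOn_nrg_UMeas hpq hμ) 1 c (c ^ 2)
  rw [one_mul] at e
  rw [← e]
  refine integral_congr_ae ?_
  filter_upwards [ae_slice hΔ, ae_slice hμ, h] with t ⟨ht, hf, _⟩ ⟨_, hf', _⟩ hx
  have e := nrg_add_smul (hpq.2.1 t ht).1 (memLp_covec hpq hΔ.1 ht) (memLp_UMeas hpq hμ.1 ht) c
  have e1 : nrg (q t) (covec p q ν t) =
      nrg (q t) (fun x => covec p q Δ t x + c * UMeas (q t) (slice μ t) x) := by
    refine nrg_congr _ ?_
    filter_upwards [ae_restrict_mem measurableSet_Icc] with x hx01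
    rw [covec, covec, hx x hx01, add_assoc]
  rw [e1, e, pairing]
  ring

/-! ### The convex cone `M₀(D)` -/

lemma measD_combination (hμ : μ ∈ measD) (hν : ν ∈ measD) (a b : NNReal) :
    a • μ + b • ν ∈ measD := by
  have := hμ.1
  have := hν.1
  refine ⟨inferInstance, ?_⟩
  rw [Measure.add_apply, Measure.smul_apply, Measure.smul_apply, hμ.2, hν.2, smul_zero, smul_zero,
    add_zero]

lemma measD0_combination (hμ : μ ∈ measD0) (hν : ν ∈ measD0) (a b : NNReal) :
    a • μ + b • ν ∈ measD0 := by
  obtain ⟨hD, κ, ⟨hκ, eκ⟩, h0, ht⟩ := hμ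
  obtain ⟨hD', κ', ⟨hκ', eκ'⟩, h0', ht'⟩ := hν
  have hap : ∀ (c : NNReal) (κ : Kernel ℝ ℝ) [IsSFiniteKernel κ], ∀ t,
      κ.withDensity (fun _ _ => (c : ENNReal)) t = c • κ t := by
    intro c κ _ t
    rw [Kernel.withDensity_apply _ measurable_const, withDensity_const]
    rfl
  refine ⟨measD_combination hD hD' a b,
    κ.withDensity (fun _ _ => (a : ENNReal)) + κ'.withDensity (fun _ _ => (b : ENNReal)),
    ⟨inferInstance, ?_⟩, ?_, ?_⟩
  · ext s hms
    rw [Measure.compProd_apply hms, Measure.add_apply, Measure.smul_apply, Measure.smul_apply, eκ,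
      eκ', Measure.compProd_apply hms, Measure.compProd_apply hms, ENNReal.smul_def,
      ENNReal.smul_def, smul_eq_mul, smul_eq_mul,
      ← lintegral_const_mul _ (Kernel.measurable_kernel_prodMk_left hms),
      ← lintegral_const_mul _ (Kernel.measurable_kernel_prodMk_left hms),
      ← lintegral_add_left ((Kernel.measurable_kernel_prodMk_left hms).const_mul _)]
    refine lintegral_congr fun t => ?_
    rw [add_apply, hap a κ, hap b κ']
    rfl
  · rw [add_apply, hap a κ, hap b κ', h0, h0', smul_zero, smul_zero, add_zero]
  · have h1 := ENNReal.Tendsto.const_mul (a := (a : ENNReal)) ht (Or.inr ENNReal.coe_ne_top)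
    have h2 := ENNReal.Tendsto.const_mul (a := (b : ENNReal)) ht' (Or.inr ENNReal.coe_ne_top)
    have h3 := h1.add h2
    rw [mul_zero, mul_zero, add_zero] at h3
    refine h3.congr fun t => ?_
    rw [add_apply, hap a κ, hap b κ']
    rfl

lemma zero_mem_measBV : (0 : Measure (ℝ × ℝ)) ∈ measBV := by
  refine ⟨⟨⟨inferInstance, rfl⟩, 0, ⟨inferInstance, ?_⟩, rfl, ?_⟩, 0, isTimeDeriv_zero⟩
  · rw [Measure.compProd_zero_right]
  · simp only [zero_apply, Measure.coe_zero, Pi.zero_apply]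
    exact tendsto_const_nhds

/-! ### Optimality -/

lemma continuousOn_etaPath (hq : ContinuousOn q I01) : ContinuousOn (etaPath q) D := by
  have h : ContinuousOn (fun z : ℝ × ℝ => (q z.1, z.2)) D :=
    (hq.comp continuousOn_fst fun z hz => hz.1).prodMk continuousOn_snd
  exact (continuous_etaC.comp_continuousOn h).congr fun z hz => eta_eq _ hz.2

/-- By uniqueness of the time derivative, the infimum defining `FRt` is a single value. -/
lemma FRt_eq {δ : SignedMeasure (ℝ × ℝ)} (hδ : IsTimeDeriv μ δ) (f : ℝ × ℝ → ℝ) :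
    FRt f μ = FR f μ δ := by
  refine le_antisymm (iInf₂_le δ hδ) (le_iInf₂ fun δ' hδ' => ?_)
  rw [hδ.unique hδ']

lemma exists_isTimeDeriv_of_FRt_ne_top {f : ℝ × ℝ → ℝ} (h : FRt f μ ≠ ⊤) :
    ∃ δ, IsTimeDeriv μ δ := by
  by_contra hc
  push Not at hc
  refine h ?_
  simp [FRt, hc]

lemma FR_etaPath_combination_le (hq : ContinuousOn q I01) (hμ : μ ∈ measD0) (hν : ν ∈ measD0)
    {δ δ' : SignedMeasure (ℝ × ℝ)} (hδ : IsTimeDeriv μ δ) (hδ' : IsTimeDeriv ν δ')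
    (a b : NNReal) : FRt (etaPath q) (a • μ + b • ν) ≤
      a * FR (etaPath q) μ δ + b * FR (etaPath q) ν δ' := by
  have := hμ.1.1
  have := hν.1.1
  rw [FRt_eq (hδ.combination hμ.1 hν.1 hδ' a b)]
  refine FR_combination_le a b
    (integrable_of_continuousOn (continuousOn_etaPath hq) ?_).aestronglyMeasurable.aemeasurable
  rw [Measure.add_apply, Measure.add_apply, Measure.add_apply, hμ.1.2, hν.1.2,
    hδ.totalVariation_compl_D, hδ'.totalVariation_compl_D]
  simp

lemma F_le_F_iff (P : L2 → L2 → ℝ) : F P p q Δ ≤ F P p q ν ↔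
    FRt (etaPath q) Δ + quad p q Δ ≤ FRt (etaPath q) ν + quad p q ν := by
  rw [← EReal.coe_ennreal_le_coe_ennreal_iff]
  exact (EReal.addLECancellable_coe _).add_le_add_iff_right

lemma nonneg_of_forall_small {x R : ℝ} (h : ∀ ε : ℝ, 0 < ε → ε < 1 → 0 ≤ ε * x + ε ^ 2 * R) :
    0 ≤ x := by
  have hlim : Tendsto (fun ε : ℝ => x + ε * R) (𝓝[>] 0) (𝓝 (x + 0 * R)) :=
    ((continuous_const.add (continuous_id.mul continuous_const)).tendsto 0).mono_left
      nhdsWithin_le_nhds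
  rw [zero_mul, add_zero] at hlim
  refine ge_of_tendsto hlim ?_
  filter_upwards [Ioo_mem_nhdsGT (zero_lt_one (α := ℝ))] with ε hε
  have h1 := h ε hε.1 hε.2
  have h2 : 0 ≤ ε * (x + ε * R) := by linarith [h1, (by ring : ε * (x + ε * R) = ε * x + ε ^ 2 * R)]
  exact nonneg_of_mul_nonneg_right h2 hε.1

/-- Comparison of a minimizer `Δ` with `a Δ + b μ`. The operator `U` sees this measure as `Δ + c μ`:
either `a = 1` and `b = c`, or `μ = Δ` and `c = a + b - 1`, which may be negative. -/
lemma variation_nonneg (hpq : (p, q) ∈ pathSet p₀ q₀) (hΔ : Δ ∈ measBV) (hμ : μ ∈ measBV)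
    {δ δ' : SignedMeasure (ℝ × ℝ)} (hδ : IsTimeDeriv Δ δ) (hδ' : IsTimeDeriv μ δ')
    (hfin : FR (etaPath q) Δ δ ≠ ⊤) (hfin' : FR (etaPath q) μ δ' ≠ ⊤) (a b : NNReal) (c : ℝ)
    (hmin : ∀ ν ∈ measD0,
      FRt (etaPath q) Δ + quad p q Δ ≤ FRt (etaPath q) ν + quad p q ν)
    (hc : ∀ᵐ t ∂(volume.restrict I01), ∀ x ∈ I01,
      a * UMeas (q t) (slice Δ t) x + b * UMeas (q t) (slice μ t) x =
        UMeas (q t) (slice Δ t) x + c * UMeas (q t) (slice μ t) x) :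
    (FR (etaPath q) Δ δ).toReal ≤
      a * (FR (etaPath q) Δ δ).toReal + b * (FR (etaPath q) μ δ').toReal +
        c * (∫ z, w p q Δ z ∂μ) +
        c ^ 2 * ∫ t in I01, nrg (q t) (UMeas (q t) (slice μ t)) := by
  have hνD := measD0_combination hΔ.1 hμ.1 a b
  have hν : a • Δ + b • μ ∈ measBV := ⟨hνD, _, hδ.combination hΔ.1.1 hμ.1.1 hδ' a b⟩
  have hline := integral_nrg_line (ν := a • Δ + b • μ) hpq hΔ hμ c (by
    filter_upwards [slice_combination hΔ.1 hμ.1 hνD a b rfl, ae_slice hΔ, ae_slice hμ, hc]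
      with t ht ⟨_, hf, _⟩ ⟨_, hf', _⟩ hx x hx01
    rw [ht, UMeas_combination _ _ _ hx01, hx x hx01])
  have h1 := (hmin _ hνD).trans (add_le_add_left
    (FR_etaPath_combination_le (continuousOn_q hpq) hΔ.1 hμ.1 hδ hδ' a b) _)
  rw [FRt_eq hδ, quad_eq hpq hΔ, quad_eq hpq hν] at h1
  have hq0 : ∀ ν : Measure (ℝ × ℝ), 0 ≤ ∫ t in I01, nrg (q t) (covec p q ν t) :=
    fun ν => integral_nonneg fun t => nrg_nonneg _ _
  have m1 : (a : ENNReal) * FR (etaPath q) Δ δ ≠ ⊤ := ENNReal.mul_ne_top ENNReal.coe_ne_top hfin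
  have m2 : (b : ENNReal) * FR (etaPath q) μ δ' ≠ ⊤ := ENNReal.mul_ne_top ENNReal.coe_ne_top hfin'
  have h2 := ENNReal.toReal_mono
    (ENNReal.add_ne_top.2 ⟨ENNReal.add_ne_top.2 ⟨m1, m2⟩, ENNReal.ofReal_ne_top⟩) h1
  rw [ENNReal.toReal_add hfin ENNReal.ofReal_ne_top,
    ENNReal.toReal_add (ENNReal.add_ne_top.2 ⟨m1, m2⟩) ENNReal.ofReal_ne_top,
    ENNReal.toReal_add m1 m2, ENNReal.toReal_mul, ENNReal.toReal_mul,
    ENNReal.toReal_ofReal (hq0 _), ENNReal.toReal_ofReal (hq0 _), hline] at h2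
  simp only [ENNReal.coe_toReal] at h2
  linarith

lemma coe_ennreal_eq_coe_toReal {x : ENNReal} (h : x ≠ ⊤) :
    (x : EReal) = ((x.toReal : ℝ) : EReal) := by
  lift x to NNReal using h
  rfl

end FisherRao

end

open FisherRao in
theorem mainTheorem2 (P : FisherRao.L2 → FisherRao.L2 → ℝ) (p₀ q₀ : FisherRao.L2)
    (p q : ℝ → FisherRao.L2) (hpq : (p, q) ∈ FisherRao.pathSet p₀ q₀)
    (Δ : Measure (ℝ × ℝ)) (hΔ : Δ ∈ FisherRao.measD0) :
    ((∀ Δ₁ ∈ FisherRao.measD0, FisherRao.F P p q Δ ≤ FisherRao.F P p q Δ₁) ↔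
      (∀ μ ∈ FisherRao.measD0, ∀ δ : SignedMeasure (ℝ × ℝ), FisherRao.IsTimeDeriv μ δ →
        ((∫ z, -FisherRao.w p q Δ z ∂μ : ℝ) : EReal) ≤
          (FisherRao.FR (FisherRao.etaPath q) μ δ : EReal)) ∧
      (∃ δ : SignedMeasure (ℝ × ℝ), FisherRao.IsTimeDeriv Δ δ ∧
        (FisherRao.FR (FisherRao.etaPath q) Δ δ : EReal)
          + ((∫ z, FisherRao.w p q Δ z ∂Δ : ℝ) : EReal) = 0)) ∧
    -- the pairings with `w` are meaningful
    (∀ δ₀ : SignedMeasure (ℝ × ℝ), FisherRao.IsTimeDeriv Δ δ₀ →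
      ∀ μ ∈ FisherRao.measD0, ∀ δ : SignedMeasure (ℝ × ℝ), FisherRao.IsTimeDeriv μ δ →
        Integrable (FisherRao.w p q Δ) μ) := by
  refine ⟨?_, fun δ₀ h₀ μ hμ δ h => integrable_w hpq ⟨hΔ, δ₀, h₀⟩ ⟨hμ, δ, h⟩⟩
  simp only [F_le_F_iff]
  constructor
  · intro hmin
    -- The value at the zero measure is finite.
    have hfin : FRt (etaPath q) Δ ≠ ⊤ := by
      have h := hmin 0 zero_mem_measBV.1
      rw [FRt_eq isTimeDeriv_zero, FR_zero, quad_eq hpq zero_mem_measBV, zero_add] at h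
      exact ((le_self_add.trans h).trans_lt ENNReal.ofReal_lt_top).ne
    obtain ⟨δ, hδ⟩ := exists_isTimeDeriv_of_FRt_ne_top hfin
    have hΔ' : Δ ∈ measBV := ⟨hΔ, δ, hδ⟩
    rw [FRt_eq hδ] at hfin
    refine ⟨fun μ hμ δ' hδ' => ?_, δ, hδ, ?_⟩
    · by_cases hfin' : FR (etaPath q) μ δ' = ⊤
      · rw [hfin']
        exact le_top
      rw [coe_ennreal_eq_coe_toReal hfin', EReal.coe_le_coe_iff, integral_neg,
        neg_le_iff_add_nonneg]
      refine nonneg_of_forall_small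
        (R := ∫ t in I01, nrg (q t) (UMeas (q t) (slice μ t))) fun ε h0 _ => ?_
      have h := variation_nonneg hpq hΔ' ⟨hμ, δ', hδ'⟩ hδ hδ' hfin hfin' 1 ε.toNNReal ε hmin
        (ae_of_all _ fun t x _ => by simp [h0.le])
      simp only [NNReal.coe_one, one_mul, Real.coe_toNNReal _ h0.le] at h
      linarith
    -- The measures `(1 + s) Δ` with `s` of either sign turn the inequality into an equality.
    · have hs : ∀ s : ℝ, -1 < s → 0 ≤ s * ((FR (etaPath q) Δ δ).toReal + ∫ z, w p q Δ z ∂Δ) +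
          s ^ 2 * ∫ t in I01, nrg (q t) (UMeas (q t) (slice Δ t)) := by
        intro s hs
        have h0 : 0 ≤ 1 + s := by linarith
        have h := variation_nonneg hpq hΔ' hΔ' hδ hδ hfin hfin (1 + s).toNNReal 0 s hmin
          (ae_of_all _ fun t x _ => by
            simp only [Real.coe_toNNReal _ h0, NNReal.coe_zero]
            ring)
        simp only [NNReal.coe_zero, zero_mul, Real.coe_toNNReal _ h0] at h
        linarith
      have h1 := nonneg_of_forall_small fun ε h0 _ => hs ε (by linarith)
      have h2 := nonneg_of_forall_small
        (x := -((FR (etaPath q) Δ δ).toReal + ∫ z, w p q Δ z ∂Δ))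
        (R := ∫ t in I01, nrg (q t) (UMeas (q t) (slice Δ t))) fun ε _ h1 => by
          have := hs (-ε) (by linarith)
          rw [neg_sq] at this
          linarith
      rw [coe_ennreal_eq_coe_toReal hfin, ← EReal.coe_add, ← EReal.coe_zero, EReal.coe_eq_coe_iff]
      linarith
  · rintro ⟨h1, δ, hδ, h2⟩ Δ₁ hΔ₁
    by_cases hfin₁ : FRt (etaPath q) Δ₁ = ⊤
    · rw [hfin₁, top_add]
      exact le_top
    obtain ⟨δ₁, hδ₁⟩ := exists_isTimeDeriv_of_FRt_ne_top hfin₁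
    have hΔ' : Δ ∈ measBV := ⟨hΔ, δ, hδ⟩
    have hΔ₁' : Δ₁ ∈ measBV := ⟨hΔ₁, δ₁, hδ₁⟩
    rw [FRt_eq hδ₁] at hfin₁
    have hfin : FR (etaPath q) Δ δ ≠ ⊤ := by
      intro h
      rw [h, EReal.coe_ennreal_top, EReal.top_add_coe] at h2
      exact EReal.top_ne_zero h2
    have h3 := h1 Δ₁ hΔ₁ δ₁ hδ₁
    rw [coe_ennreal_eq_coe_toReal hfin₁, EReal.coe_le_coe_iff, integral_neg] at h3
    rw [coe_ennreal_eq_coe_toReal hfin, ← EReal.coe_add, ← EReal.coe_zero,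
      EReal.coe_eq_coe_iff] at h2
    have h4 := add_integral_w_sub_le hpq hΔ' hΔ₁'
    have hq0 : ∀ ν : Measure (ℝ × ℝ), 0 ≤ ∫ t in I01, nrg (q t) (covec p q ν t) :=
      fun ν => integral_nonneg fun t => nrg_nonneg _ _
    rw [FRt_eq hδ, FRt_eq hδ₁, quad_eq hpq hΔ', quad_eq hpq hΔ₁', ← ENNReal.ofReal_toReal hfin,
      ← ENNReal.ofReal_toReal hfin₁, ← ENNReal.ofReal_add ENNReal.toReal_nonneg (hq0 _),
      ← ENNReal.ofReal_add ENNReal.toReal_nonneg (hq0 _)]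
    refine ENNReal.ofReal_le_ofReal ?_
    linarith
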